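/- **Conventions (graphs).** A graph is a finite directed multigraph. Fix a type graph $TG$; a typed graph is a graph $G$ with a graph morphism $\mathrm{type}_G: G\to TG$, and morphisms of typed graphs preserve types. The degree $\deg_G(v)$ is the number of edges with source $v$ plus the number of edges with target $v$. A rule is $p=(L\leftarrow K\to R)$ with typed graphs $L,K,R$ and inclusions (injective morphisms) $K\to L$, $K\to R$; a graph transformation system (GTS) over $TG$ is a set of rules. $G\Rightarrow_S H$ means that for some rule of $S$ and some injective match $m:L\to G$ there are a typed graph $D$ and morphisms making $L\leftarrow K\to D$, $L\to G\leftarrow D$ and $R\leftarrow K\to D$, $R\to H\leftarrow D$ two pushout squares in the category of typed graphs. $G$ is final for $S$ if there is no $H$ with $G\Rightarrow_S H$. Two GTS $S_1,S_2$ over $TG$ are *operationally equivalent* if for every graph $G$ typed over $TG$ there are $G\Rightarrow^*_{S_1}G_1$ and $G\Rightarrow^*_{S_2}G_2$ with $G_i$ final for $S_i$ and $G_1\cong G_2$ as typed graphs. **Conventions (CHR).** Let $\mathcal{CT}$ be a complete first-order theory with equality over some signature of built-in symbols that has constants for the integers, pairwise distinct in $\mathcal{CT}$, and binary functions $+,-$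 with the correct values on these constants. Let variables come from an infinite set. A state $\langle \mathbb G;\mathbb B;\mathbb V\rangle$ consists of a finite multiset $\mathbb G$ of user-defined constraints, a finite conjunction $\mathbb B$ of atomic built-in constraints and a finite set $\mathbb V$ of (global) variables. State equivalence $\equiv$ is the smallest equivalence relation such that (1) $\langle\mathbb G;x\doteq t\wedge\mathbb B;\mathbb V\rangle\equiv\langle\mathbb G[x/t];x\doteq t\wedge\mathbb B;\mathbb V\rangle$; (2) $\langle\mathbb G;\mathbb B;\mathbb V\rangle\equiv\langle\mathbb G;\mathbb B';\mathbb V\rangle$ if $\mathcal{CT}\models\exists\bar s.\mathbb B\leftrightarrow\exists\bar s'.\mathbb B'$, with $\bar s,\bar s'$ the variables of $\mathbb B$, $\mathbb B'$ that are neither in $\mathbb V$ nor occur in $\mathbb G$; (3) $\langle\mathbb G;\mathbb B;\{X\}\cup\mathbb V\rangle\equiv\langle\mathbb G;\mathbb B;\mathbb V\rangle$ if $X$ does not occur in $\mathbb G,\mathbb B$; (4) $\langle\mathbb G;\bot;\mathbb V\rangle\equiv\langle\mathbb G';\bot;\mathbb V\rangle$. For a program $P$ (a set of rules $H_1\backslash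 H_2\Leftrightarrow g\mid B_c,B_b$), transitions between equivalence classes are $$[\langle H_1\uplus H_2\uplus\mathbb G;\,g\wedge\mathbb B;\,\mathbb V\rangle]\rightarrowtail_P[\langle H_1\uplus B_c\uplus\mathbb G;\,g\wedge B_b\wedge\mathbb B;\,\mathbb V\rangle]$$ for a copy of a rule of $P$ with fresh variables (none of them in $\mathbb V$; those occurring only in the body do not occur in $\mathbb G,\mathbb B$), provided the built-in store of the left state is consistent, $\mathcal{CT}\models\exists(g\wedge\mathbb B)$; thus failed states have no transitions. A state is final for $P$ if it has no transition. Programs $P_1,P_2$ are *operationally equivalent* if for every state $\sigma$ there are $\sigma\rightarrowtail_{P_1}^*\sigma_1$ and $\sigma\rightarrowtail_{P_2}^*\sigma_2$ with $\sigma_1\equiv\sigma_2$ and $\sigma_i$ final for $P_i$. **Encoding.** The user-defined constraint symbols are one symbol of arity 2 for each node and one of arity 3 for each edge of $TG$. For a rule $p=(L\leftarrow K\to R)$ choose pairwise distinct variables: $X_x$ for the nodes and edges $x$ of $L$ and of $R\setminus K$, $D_v$ for the nodes $v$ of $L$, and $X_{v'},D_{v'}$ for the nodes $v$ of $K$. A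 node $v$ gives a constraint $\mathrm{type}(v)(X_v,\cdot)$ and an edge $e$ the constraint $\mathrm{type}(e)(X_e,X_{\mathrm{src}(e)},X_{\mathrm{tgt}(e)})$. The rule $\varrho(p)$ is the simplification rule $C_L\Leftrightarrow C_R^u,C_R^b$ where $C_L$ consists of $\mathrm{type}(v)(X_v,D_v)$ for the nodes $v$ of $K$, $\mathrm{type}(v)(X_v,\deg_L(v))$ for the nodes $v$ of $L\setminus K$, and the edge constraints of $L$; $C_R^u$ consists of $\mathrm{type}(v)(X_v,\deg_R(v))$ for the nodes $v$ of $R\setminus K$, the edge constraints of $R\setminus K$ and of $K$, and $\mathrm{type}(v)(X_{v'},D_{v'})$ for the nodes $v$ of $K$; and $C_R^b$ is the conjunction of $X_v=X_{v'}$ and $D_{v'}=D_v-\deg_L(v)+\deg_R(v)$ over the nodes $v$ of $K$. The GTS-CHR program of a GTS $S$ is $\{\varrho(p)\mid p\in S\}$. **Theorem (GTS-CHR Operational Equivalence).** Let $S_1,S_2$ be graph transformation systems over the same type graph $TG$, and let $P_1,P_2$ be their GTS-CHR programs. If $P_1$ and $P_2$ are operationally equivalent, then $S_1$ and $S_2$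 are operationally equivalent. -/

import Mathlib

universe u a b w

namespace GTSCHR

/-! ### Typed graphs -/

/-- A finite directed multigraph. -/
structure DirGraph where
  V : Type u
  E : Type u
  [fintypeV : Fintype V]
  [fintypeE : Fintype E]
  src : E → V
  tgt : E → V

attribute [instance] DirGraph.fintypeV DirGraph.fintypeE

open Classical in
/-- The degree of a node: outgoing plus incoming edges (so a loop counts twice). -/
noncomputable def DirGraph.deg (G : DirGraph.{u}) (v : G.V) : ℕ :=
  (Finset.univ.filter fun e => G.src e = v).card +
    (Finset.univ.filter fun e => G.tgt e = v).card

@[ext]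
structure DirGraph.Hom (G H : DirGraph.{u}) where
  onV : G.V → H.V
  onE : G.E → H.E
  src_comm : ∀ e, onV (G.src e) = H.src (onE e)
  tgt_comm : ∀ e, onV (G.tgt e) = H.tgt (onE e)

/-- A graph typed over the type graph `TG`. -/
structure TypedGraph (TG : DirGraph.{u}) where
  graph : DirGraph.{u}
  type : DirGraph.Hom graph TG

variable {TG : DirGraph.{u}}

/-- Type-preserving graph morphisms. -/
@[ext]
structure TypedGraph.Hom (G H : TypedGraph TG) extends DirGraph.Hom G.graph H.graph where
  typeV_comm : ∀ v, H.type.onV (onV v) = G.type.onV v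
  typeE_comm : ∀ e, H.type.onE (onE e) = G.type.onE e

/-- The category of graphs typed over `TG`. -/
instance : CategoryTheory.Category (TypedGraph TG) where
  Hom := TypedGraph.Hom
  id _ :=
    { onV := id, onE := id
      src_comm := fun _ => rfl, tgt_comm := fun _ => rfl
      typeV_comm := fun _ => rfl, typeE_comm := fun _ => rfl }
  comp f g :=
    { onV := g.onV ∘ f.onV, onE := g.onE ∘ f.onE
      src_comm := fun e => by simp [f.src_comm, g.src_comm]
      tgt_comm := fun e => by simp [f.tgt_comm, g.tgt_comm]
      typeV_comm := fun v => by simp [f.typeV_comm, g.typeV_comm]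
      typeE_comm := fun e => by simp [f.typeE_comm, g.typeE_comm] }

/-! ### Graph transformation systems (double pushout, injective matches) -/

section GTS

open CategoryTheory

/-- A graph production rule `L ← K → R`.  The two inclusions are given by injective morphisms. -/
structure ProdRule (TG : DirGraph.{u}) where
  L : TypedGraph TG
  K : TypedGraph TG
  R : TypedGraph TG
  l : K ⟶ L
  r : K ⟶ R
  l_injV : Function.Injective l.onV
  l_injE : Function.Injective l.onE
  r_injV : Function.Injective r.onV
  r_injE : Function.Injective r.onE

/-- A graph transformation system over the type graph `TG`: a set of production rules. -/
structure GTS (TG : DirGraph.{u}) where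
  rules : Set (ProdRule TG)

/-- `DirectDerivation p G H m`: `H` arises from `G` by applying `p` at the injective match `m`,
i.e. there are two pushout squares
```
  L <-l- K -r-> R
  |m     |k     |n
  G <-f- D -g-> H
```
in the category of typed graphs. -/
def DirectDerivation (p : ProdRule TG) (G H : TypedGraph TG) (m : p.L ⟶ G) : Prop :=
  Function.Injective m.onV ∧ Function.Injective m.onE ∧
    ∃ (D : TypedGraph TG) (k : p.K ⟶ D) (f : D ⟶ G) (g : D ⟶ H) (n : p.R ⟶ H),
      IsPushout p.l k m f ∧ IsPushout p.r k n g

/-- One transformation step of the system `S`. -/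
def GTS.Step (S : GTS TG) (G H : TypedGraph TG) : Prop :=
  ∃ p ∈ S.rules, ∃ m : p.L ⟶ G, DirectDerivation p G H m

def GTS.Final (S : GTS TG) (G : TypedGraph TG) : Prop :=
  ∀ H, ¬ S.Step G H

/-- `G` reduces in both systems to final graphs that are isomorphic as typed graphs. -/
def GTS.Joinable (S₁ S₂ : GTS TG) (G : TypedGraph TG) : Prop :=
  ∃ G₁ G₂ : TypedGraph TG,
    Relation.ReflTransGen S₁.Step G G₁ ∧ Relation.ReflTransGen S₂.Step G G₂ ∧
      Nonempty (G₁ ≅ G₂) ∧ S₁.Final G₁ ∧ S₂.Final G₂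

def GTS.OperationallyEquivalent (S₁ S₂ : GTS TG) : Prop :=
  ∀ G : TypedGraph TG, GTS.Joinable S₁ S₂ G

end GTS

/-! ### Constraint Handling Rules -/

section CHR

open FirstOrder FirstOrder.Language

/-- A constraint theory over a first-order language `L` of built-in function and relation symbols:
a complete theory of first-order logic with equality that covers the arithmetic operations `+` and
`-`, i.e. there is a constant for every integer, distinct constants are different, and sums and
differences of the constants have the right values.  (Nothing is required of the other symbols of
`L`; in particular they may satisfy the remaining axioms of Clark's equality theory.) -/
structure ConstraintTheory (L : FirstOrder.Language.{a, b}) where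
  theory : L.Theory
  complete : theory.IsComplete
  num : ℤ → L.Constants
  add : L.Functions 2
  sub : L.Functions 2
  num_ne : ∀ m n : ℤ, m ≠ n →
    theory ⊨ᵇ (Formula.not ((num m).term.equal (num n).term) : L.Sentence)
  num_add : ∀ m n : ℤ,
    theory ⊨ᵇ ((add.apply₂ (num m).term (num n).term).equal (num (m + n)).term : L.Sentence)
  num_sub : ∀ m n : ℤ,
    theory ⊨ᵇ ((sub.apply₂ (num m).term (num n).term).equal (num (m - n)).term : L.Sentence)

/-- The (bundled, nonempty) models of a constraint theory. -/
abbrev ConstraintTheory.Model {L : FirstOrder.Language.{a, b}} (CT : ConstraintTheory L) :=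
  Theory.ModelType.{a, b, max a b} CT.theory

/-- The set of variables occurring in a term. -/
def termVars {L : FirstOrder.Language.{a, b}} {X : Type w} : L.Term X → Set X
  | .var x => {x}
  | .func _ ts => ⋃ i, termVars (ts i)

/-- A user-defined constraint `c(t₁, …, tₙ)` with a constraint symbol `c` of the given arity. -/
structure UserConstraint (L : FirstOrder.Language.{a, b}) {C : Type u} (arity : C → ℕ) (X : Type w) where
  sym : C
  args : Fin (arity sym) → L.Term X

/-- Atomic built-in constraints. -/
inductive Builtin (L : FirstOrder.Language.{a, b}) (X : Type w) where
  | top : Builtin L X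
  | bot : Builtin L X
  | eq (s t : L.Term X) : Builtin L X
  | rel {n : ℕ} (R : L.Relations n) (ts : Fin n → L.Term X) : Builtin L X

variable {L : FirstOrder.Language.{a, b}} {C : Type u} {arity : C → ℕ} {X : Type w}

namespace UserConstraint

def vars (c : UserConstraint L arity X) : Set X :=
  ⋃ i, termVars (c.args i)

open Classical in
/-- The substitution `c[x/t]`. -/
noncomputable def subst (c : UserConstraint L arity X) (x : X) (t : L.Term X) :
    UserConstraint L arity X :=
  ⟨c.sym, fun i => (c.args i).subst fun y => if y = x then t else Term.var y⟩

def rename (ρ : X → X) (c : UserConstraint L arity X) : UserConstraint L arity X :=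
  ⟨c.sym, fun i => (c.args i).relabel ρ⟩

end UserConstraint

namespace Builtin

def vars : Builtin L X → Set X
  | .top => ∅
  | .bot => ∅
  | .eq s t => termVars s ∪ termVars t
  | .rel _ ts => ⋃ i, termVars (ts i)

def rename (ρ : X → X) : Builtin L X → Builtin L X
  | .top => .top
  | .bot => .bot
  | .eq s t => .eq (s.relabel ρ) (t.relabel ρ)
  | .rel R ts => .rel R fun i => (ts i).relabel ρ

/-- Truth of a built-in constraint in a structure under a valuation of the variables. -/
def Holds {M : Type*} [L.Structure M] (ν : X → M) : Builtin L X → Prop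
  | .top => True
  | .bot => False
  | .eq s t => s.realize ν = t.realize ν
  | .rel R ts => Structure.RelMap R fun i => (ts i).realize ν

end Builtin

/-- Variables of a multiset of user-defined constraints. -/
def goalVars (G : Multiset (UserConstraint L arity X)) : Set X :=
  {x | ∃ c ∈ G, x ∈ c.vars}

/-- Variables of a conjunction (list) of built-in constraints. -/
def storeVars (B : List (Builtin L X)) : Set X :=
  {x | ∃ c ∈ B, x ∈ c.vars}

/-- Truth of a conjunction of built-in constraints. -/
def StoreHolds {M : Type*} [L.Structure M] (ν : X → M) (B : List (Builtin L X)) : Prop :=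
  ∀ c ∈ B, c.Holds ν

/-- Truth of `∃ s̄. B`, where `s̄` consists of all variables outside `W`. -/
def ExistsHolds {M : Type*} [L.Structure M] (W : Set X) (ν : X → M) (B : List (Builtin L X)) :
    Prop :=
  ∃ ν' : X → M, (∀ x ∈ W, ν' x = ν x) ∧ StoreHolds ν' B

/-- A CHR state: goal, built-in store (a conjunction) and global variables. -/
structure CHRState (L : FirstOrder.Language.{a, b}) {C : Type u} (arity : C → ℕ) (X : Type w) where
  goal : Multiset (UserConstraint L arity X)
  store : List (Builtin L X)
  globals : Finset X

open Classical in
/-- The conditions generating state equivalence. -/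
inductive EquivGen (CT : ConstraintTheory L) :
    CHRState L arity X → CHRState L arity X → Prop
  | substitution (G : Multiset (UserConstraint L arity X)) (x : X) (t : L.Term X)
      (B : List (Builtin L X)) (V : Finset X) :
      EquivGen CT ⟨G, .eq (.var x) t :: B, V⟩ ⟨G.map (·.subst x t), .eq (.var x) t :: B, V⟩
  /-- The strictly local variables are those outside `V ∪ vars G`. -/
  | transformation (G : Multiset (UserConstraint L arity X)) (B B' : List (Builtin L X))
      (V : Finset X)
      (h : ∀ (M : CT.Model) (ν : X → M),
        ExistsHolds (↑V ∪ goalVars G) ν B ↔ ExistsHolds (↑V ∪ goalVars G) ν B') :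
      EquivGen CT ⟨G, B, V⟩ ⟨G, B', V⟩
  | omission (G : Multiset (UserConstraint L arity X)) (B : List (Builtin L X)) (x : X)
      (V : Finset X) (hG : x ∉ goalVars G) (hB : x ∉ storeVars B) :
      EquivGen CT ⟨G, B, insert x V⟩ ⟨G, B, V⟩
  | failed (G G' : Multiset (UserConstraint L arity X)) (V : Finset X) :
      EquivGen CT ⟨G, [.bot], V⟩ ⟨G', [.bot], V⟩

/-- State equivalence `≡`: the smallest equivalence relation satisfying the conditions above. -/
def stateSetoid (CT : ConstraintTheory L) (arity : C → ℕ) (X : Type w) :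
    Setoid (CHRState L arity X) :=
  Relation.EqvGen.setoid (EquivGen CT)

/-- Equivalence classes of CHR states. -/
abbrev StateClass (CT : ConstraintTheory L) (arity : C → ℕ) (X : Type w) :=
  Quotient (stateSetoid CT arity X)

/-- The class of a state. -/
def CHRState.cls (CT : ConstraintTheory L) (σ : CHRState L arity X) : StateClass CT arity X :=
  Quotient.mk (stateSetoid CT arity X) σ

/-- A CHR rule `kept \ removed ⇔ guard | bodyUser, bodyBuiltin`. -/
structure CHRRule (L : FirstOrder.Language.{a, b}) {C : Type u} (arity : C → ℕ) (X : Type w) where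
  kept : Multiset (UserConstraint L arity X)
  removed : Multiset (UserConstraint L arity X)
  guard : List (Builtin L X)
  bodyUser : Multiset (UserConstraint L arity X)
  bodyBuiltin : List (Builtin L X)

namespace CHRRule

/-- Variables of the head and the guard. -/
def headVars (r : CHRRule L arity X) : Set X :=
  goalVars r.kept ∪ goalVars r.removed ∪ storeVars r.guard

/-- Variables that occur in the body only. -/
def bodyOnlyVars (r : CHRRule L arity X) : Set X :=
  (goalVars r.bodyUser ∪ storeVars r.bodyBuiltin) \ r.headVars

def rename (ρ : X → X) (r : CHRRule L arity X) : CHRRule L arity X where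
  kept := r.kept.map (UserConstraint.rename ρ)
  removed := r.removed.map (UserConstraint.rename ρ)
  guard := r.guard.map (Builtin.rename ρ)
  bodyUser := r.bodyUser.map (UserConstraint.rename ρ)
  bodyBuiltin := r.bodyBuiltin.map (Builtin.rename ρ)

end CHRRule

/-- A CHR program is a set of CHR rules. -/
abbrev CHRProgram (L : FirstOrder.Language.{a, b}) {C : Type u} (arity : C → ℕ) (X : Type w) :=
  Set (CHRRule L arity X)

/-- The transition relation on equivalence classes of states.  A rule is applied through a copy
`r.rename ρ` with fresh variables: none of them is global, and those that occur only in the body do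
not occur in the rest of the state (variables of the head may occur there, as they are linked to
the state by equations in `B`).  Rules are applied to states with a consistent built-in store; a
failed state has no transition. -/
inductive CHRStep (CT : ConstraintTheory L) (P : CHRProgram L arity X) :
    StateClass CT arity X → StateClass CT arity X → Prop
  | apply (r₀ : CHRRule L arity X) (hr₀ : r₀ ∈ P) (ρ : X → X) (hρ : Function.Injective ρ)
      (r : CHRRule L arity X) (hr : r = r₀.rename ρ)
      (G : Multiset (UserConstraint L arity X)) (B : List (Builtin L X)) (V : Finset X)
      (hV : Disjoint (r.headVars ∪ r.bodyOnlyVars) ↑V)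
      (hGB : Disjoint r.bodyOnlyVars (goalVars G ∪ storeVars B))
      (hcons : ∀ M : CT.Model, ∃ ν : X → M, StoreHolds ν (r.guard ++ B)) :
      CHRStep CT P
        (CHRState.cls CT ⟨r.kept + r.removed + G, r.guard ++ B, V⟩)
        (CHRState.cls CT ⟨r.kept + r.bodyUser + G, r.guard ++ r.bodyBuiltin ++ B, V⟩)

def CHRFinal (CT : ConstraintTheory L) (P : CHRProgram L arity X)
    (s : StateClass CT arity X) : Prop :=
  ∀ s', ¬ CHRStep CT P s s'

/-- `σ` has computations in both programs that end in equivalent final states. -/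
def CHRJoinable (CT : ConstraintTheory L) (P₁ P₂ : CHRProgram L arity X)
    (σ : CHRState L arity X) : Prop :=
  ∃ σ₁ σ₂ : CHRState L arity X,
    Relation.ReflTransGen (CHRStep CT P₁) (σ.cls CT) (σ₁.cls CT) ∧
      Relation.ReflTransGen (CHRStep CT P₂) (σ.cls CT) (σ₂.cls CT) ∧
      (stateSetoid CT arity X).r σ₁ σ₂ ∧
      CHRFinal CT P₁ (σ₁.cls CT) ∧ CHRFinal CT P₂ (σ₂.cls CT)

def CHROperationallyEquivalent (CT : ConstraintTheory L) (P₁ P₂ : CHRProgram L arity X) : Prop :=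
  ∀ σ : CHRState L arity X, CHRJoinable CT P₁ P₂ σ

/-! ### The encoding of a graph transformation system -/

/-- The constraint symbols for a type graph: one symbol of arity 2 per node and one symbol of
arity 3 per edge. -/
def typeArity (TG : DirGraph.{u}) : TG.V ⊕ TG.E → ℕ :=
  Sum.elim (fun _ => 2) (fun _ => 3)

/-- The constraint `v(s, t)` for a node `v` of the type graph. -/
def nodeConstraint (v : TG.V) (s t : L.Term X) : UserConstraint L (typeArity TG) X :=
  ⟨Sum.inl v, (![s, t] : Fin 2 → L.Term X)⟩

/-- The constraint `e(s, t₁, t₂)` for an edge `e` of the type graph. -/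
def edgeConstraint (e : TG.E) (s t₁ t₂ : L.Term X) : UserConstraint L (typeArity TG) X :=
  ⟨Sum.inr e, (![s, t₁, t₂] : Fin 3 → L.Term X)⟩

/-- The variable names that the encoding of a rule `L ← K → R` needs: identifiers and degree
variables for `L` (shared by `K`), identifiers for the new nodes and edges of `R`, and the additional
identifier and degree variable of the copy `v'` of every node `v` of `K`. -/
inductive RuleVar (p : ProdRule TG) : Type u
  | node (v : p.L.graph.V)
  | edge (e : p.L.graph.E)
  | degree (v : p.L.graph.V)
  | newNode (v : p.R.graph.V)
  | newEdge (e : p.R.graph.E)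
  | primeNode (v : p.K.graph.V)
  | primeDegree (v : p.K.graph.V)

open Classical in
/-- The identifier of a node of `R`; nodes of `K` keep the identifier that they have in `L`. -/
noncomputable def RuleVar.nodeR (p : ProdRule TG) (v : p.R.graph.V) : RuleVar p :=
  if h : ∃ k, p.r.onV k = v then .node (p.l.onV h.choose) else .newNode v

variable (CT : ConstraintTheory L)

section Encode

variable (p : ProdRule TG) (η : RuleVar p ↪ X)

open Classical in
/-- The head `C_L`: nodes of `K` carry their degree variable, deleted nodes their degree. -/
noncomputable def headOf : Multiset (UserConstraint L (typeArity TG) X) :=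
  (Finset.univ : Finset p.L.graph.V).val.map (fun v =>
      nodeConstraint (p.L.type.onV v) (.var (η (.node v)))
        (if v ∈ Set.range p.l.onV then .var (η (.degree v))
          else (CT.num (p.L.graph.deg v)).term)) +
    (Finset.univ : Finset p.L.graph.E).val.map (fun e =>
      edgeConstraint (p.L.type.onE e) (.var (η (.edge e)))
        (.var (η (.node (p.L.graph.src e)))) (.var (η (.node (p.L.graph.tgt e)))))

open Classical in
/-- The user-defined part `C_R^u` of the body: new nodes, new edges, edges of `K`, and the copies
`v'` of the nodes `v` of `K`. -/
noncomputable def bodyUserOf : Multiset (UserConstraint L (typeArity TG) X) :=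
  ((Finset.univ : Finset p.R.graph.V).filter (· ∉ Set.range p.r.onV)).val.map (fun v =>
      nodeConstraint (p.R.type.onV v) (.var (η (.newNode v)))
        (CT.num (p.R.graph.deg v)).term) +
    ((Finset.univ : Finset p.R.graph.E).filter (· ∉ Set.range p.r.onE)).val.map (fun e =>
      edgeConstraint (p.R.type.onE e) (.var (η (.newEdge e)))
        (.var (η (RuleVar.nodeR p (p.R.graph.src e))))
        (.var (η (RuleVar.nodeR p (p.R.graph.tgt e))))) +
    (Finset.univ : Finset p.K.graph.E).val.map (fun e =>
      edgeConstraint (p.K.type.onE e) (.var (η (.edge (p.l.onE e))))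
        (.var (η (.node (p.l.onV (p.K.graph.src e)))))
        (.var (η (.node (p.l.onV (p.K.graph.tgt e)))))) +
    (Finset.univ : Finset p.K.graph.V).val.map (fun v =>
      nodeConstraint (p.K.type.onV v) (.var (η (.primeNode v))) (.var (η (.primeDegree v))))

/-- The built-in part `C_R^b` of the body: for every node `v` of `K` the constraints
`var v = var v'` and `dvar v' = dvar v - deg_L v + deg_R v`. -/
noncomputable def bodyBuiltinOf : List (Builtin L X) :=
  (Finset.univ : Finset p.K.graph.V).toList.flatMap fun v =>
    [.eq (.var (η (.node (p.l.onV v)))) (.var (η (.primeNode v))),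
      .eq (.var (η (.primeDegree v)))
        (CT.add.apply₂
          (CT.sub.apply₂ (.var (η (.degree (p.l.onV v))))
            (CT.num (p.L.graph.deg (p.l.onV v))).term)
          (CT.num (p.R.graph.deg (p.r.onV v))).term)]

/-- The CHR simplification rule that encodes a production rule. -/
noncomputable def encodeRule : CHRRule L (typeArity TG) X where
  kept := 0
  removed := headOf CT p η
  guard := []
  bodyUser := bodyUserOf CT p η
  bodyBuiltin := bodyBuiltinOf CT p η

end Encode

/-- The GTS-CHR program of a graph transformation system, for a choice `η` of the distinct
variables used in the encoding of each rule. -/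
def gtsProgram (S : GTS TG) (η : (p : ProdRule TG) → RuleVar p ↪ X) :
    CHRProgram L (typeArity TG) X :=
  {r | ∃ p ∈ S.rules, r = encodeRule CT p (η p)}

end CHR

end GTSCHR

/-! ### Preliminaries: indexed multisets, substitutions, ground instances, models -/

namespace GTSCHR

open FirstOrder FirstOrder.Language

/-! ### Multisets indexed by finite types -/

/-! Encode a graph `G` as a CHR state, run both programs on it, and read the two computations back
as graph transformations. The difficulty is that transitions act on equivalence classes, whose
members may differ widely in syntax. The bridge is the semantic invariant `Represents`: the goal is
indexed by the nodes and edges of `G`, and, in every model and for every prescription of the global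
variables, the ground instances allowed by the store are exactly the ground encodings of `G` with
correct degrees and arbitrary identifiers.

This invariant fits state equivalence in three ways. It is preserved by each generator of `≡`
(`represents_of_equiv`). All states representing `G` are equivalent, because each reduces to a flat
encoding of `G` over fresh variables (`Represents.equiv`). One state represents at most one graph up
to isomorphism (`Represents.nonempty_iso`): numerals make every model infinite, so some instance has
distinct identifiers, and the graph can be read off from it.

The encoded rules simulate double pushouts. Matching the head against a goal multiset gives an
injective match, and the constant degree carried by each deleted node says that no edge outside the
match is attached to it, which is the dangling condition (`noDangling_iff_deg`). Under that
condition the double pushout exists explicitly as `result`, and the arithmetic of the body computes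
its degrees. Hence a transition from a state of `G` yields a state of some `H` with `G ⇒ H`
(`Represents.exists_derivation`, `Represents.exists_step`). Conversely, if a rule of the system
applies to `G`, some state of `G` contains the encoded head literally
(`exists_represents_headOf_add`); since all states of `G` are equivalent, each has a transition, so
a final state represents a final graph (`Represents.final`).

The two equivalent final CHR states therefore represent final graphs reachable from `G`, and these
graphs are isomorphic because they are represented by one class. -/

/-- The function depends on the membership proof because `α` may be empty, so no value is available
outside `t`. -/
theorem exists_map_of_rel {α ι : Type*} {r : α → ι → Prop} (t : Finset ι) :
    ∀ {s : Multiset α}, Multiset.Rel r s t.val →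
      ∃ c : (i : ι) → i ∈ t → α, s = t.val.attach.map (fun i => c i.1 i.2) ∧
        ∀ i hi, r (c i hi) i := by
  classical
  induction t using Finset.induction with
  | empty =>
    intro s h
    refine ⟨fun i hi => absurd hi (Finset.notMem_empty i), ?_, fun i hi => absurd hi (Finset.notMem_empty i)⟩
    simpa using h
  | insert a t ha ih =>
    intro s h
    rw [Finset.insert_val_of_notMem ha, Multiset.rel_cons_right] at h
    obtain ⟨x, s', hx, hs', rfl⟩ := h
    obtain ⟨c, hc, hr⟩ := ih hs'
    refine ⟨fun i hi => if h : i = a then x else c i ((Finset.mem_insert.1 hi).resolve_left h), ?_, ?_⟩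
    · have key : ∀ (u : Multiset ι) (hu : u = a ::ₘ t.val) (f : (i : ι) → i ∈ u → α),
          u.attach.map (fun i => f i.1 i.2) =
            f a (hu ▸ Multiset.mem_cons_self a _) ::ₘ t.val.attach.map
              (fun i => f i.1 (hu ▸ Multiset.mem_cons_of_mem i.2)) := by
        rintro u rfl f
        simp [Multiset.attach_cons]
      rw [key _ (Finset.insert_val_of_notMem ha)
        (fun i hi => if h : i = a then x else c i ((Finset.mem_insert.1 hi).resolve_left h)), hc]
      simp only [dite_true]
      congr 1
      refine Multiset.map_congr rfl fun i _ => ?_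
      have : i.1 ≠ a := fun h => ha (h ▸ i.2)
      simp [this]
    · intro i hi
      by_cases h : i = a
      · subst h; simpa using hx
      · simpa [h] using hr i _

theorem exists_map_univ_of_rel {α ι : Type*} [Fintype ι] {r : α → ι → Prop} {s : Multiset α}
    (h : Multiset.Rel r s (Finset.univ : Finset ι).val) :
    ∃ c : ι → α, s = (Finset.univ : Finset ι).val.map c ∧ ∀ i, r (c i) i := by
  obtain ⟨c, hc, hr⟩ := exists_map_of_rel _ h
  refine ⟨fun i => c i (Finset.mem_univ i), ?_, fun i => hr i _⟩
  rw [hc, Multiset.attach_map_val' _ (fun i => c i (Finset.mem_univ i))]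

theorem exists_map_univ_of_map_eq {α β ι : Type*} [Fintype ι] {s : Multiset α} {f : α → β}
    {g : ι → β} (h : s.map f = (Finset.univ : Finset ι).val.map g) :
    ∃ c : ι → α, s = (Finset.univ : Finset ι).val.map c ∧ ∀ i, f (c i) = g i := by
  rw [← Multiset.rel_eq, Multiset.rel_map] at h
  exact exists_map_univ_of_rel h

/-- Lifting one indexing along the other gives a map whose image multiset is all of `univ`: free of
repetitions, hence injective, and full, hence surjective. This turns equality of goals into a
bijection of constraints, and is the source of the injectivity of matches. -/
theorem exists_equiv_of_map_univ_eq {α ι κ : Type*} [Fintype ι] [Fintype κ] {c : ι → α} {d : κ → α}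
    (h : (Finset.univ : Finset ι).val.map c = (Finset.univ : Finset κ).val.map d) :
    ∃ e : ι ≃ κ, ∀ i, d (e i) = c i := by
  obtain ⟨f, hf, hfc⟩ := exists_map_univ_of_map_eq h.symm
  have hinj : Function.Injective f := by
    have h1 : ((Finset.univ : Finset ι).val.map f).Nodup := hf ▸ (Finset.univ : Finset κ).nodup
    intro i j hij
    exact Multiset.inj_on_of_nodup_map h1 i (Finset.mem_univ _) j (Finset.mem_univ _) hij
  have hsurj : Function.Surjective f := by
    intro k
    have : k ∈ (Finset.univ : Finset ι).val.map f := hf ▸ Finset.mem_univ k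
    obtain ⟨i, _, hi⟩ := Multiset.mem_map.1 this
    exact ⟨i, hi⟩
  exact ⟨Equiv.ofBijective f ⟨hinj, hsurj⟩, hfc⟩

theorem map_univ_sum {α ι κ : Type*} [Fintype ι] [Fintype κ] (f : ι ⊕ κ → α) :
    (Finset.univ : Finset (ι ⊕ κ)).val.map f =
      (Finset.univ : Finset ι).val.map (fun i => f (.inl i)) +
        (Finset.univ : Finset κ).val.map (fun i => f (.inr i)) := by
  rw [← Finset.univ_disjSum_univ, Finset.val_disjSum, Multiset.disjSum, Multiset.map_add,
    Multiset.map_map, Multiset.map_map]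
  rfl

theorem map_univ_equiv {α ι κ : Type*} [Fintype ι] [Fintype κ] (e : ι ≃ κ) (f : κ → α) :
    (Finset.univ : Finset κ).val.map f =
      (Finset.univ : Finset ι).val.map (fun i => f (e i)) := by
  rw [← Finset.map_univ_equiv e, Finset.map_val, Multiset.map_map]
  rfl

theorem exists_map_univ_fin {α : Type*} (s : Multiset α) :
    ∃ (n : ℕ) (g : Fin n → α), s = (Finset.univ : Finset (Fin n)).val.map g := by
  induction s using Quotient.inductionOn with
  | h l => exact ⟨l.length, l.get, by
      rw [Fin.univ_val_map]; simp⟩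

theorem map_filter_univ {α ι : Type*} [Fintype ι] (P : ι → Prop) [DecidablePred P] (f : ι → α) :
    (Finset.univ.filter P).val.map f =
      (Finset.univ : Finset {i // P i}).val.map (fun i : {i // P i} => f i.1) := by
  have : Finset.univ.filter P = (Finset.univ : Finset {i // P i}).map (Function.Embedding.subtype P) := by
    ext x; simp
  rw [this, Finset.map_val, Multiset.map_map]
  rfl

/-! ### Variables, substitutions and renamings -/

variable {L : FirstOrder.Language.{a, b}} {C : Type u} {arity : C → ℕ} {X : Type w}

theorem realize_congr {M : Type*} [L.Structure M] {ν ν' : X → M} (t : L.Term X)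
    (h : ∀ x ∈ termVars t, ν x = ν' x) : t.realize ν = t.realize ν' := by
  induction t with
  | var x => exact h x rfl
  | func f ts ih =>
    simp only [Term.realize_func]
    congr 1
    funext i
    exact ih i fun x hx => h x (Set.mem_iUnion.2 ⟨i, hx⟩)

theorem Builtin.holds_congr {M : Type*} [L.Structure M] {ν ν' : X → M} (c : Builtin L X)
    (h : ∀ x ∈ c.vars, ν x = ν' x) : c.Holds ν ↔ c.Holds ν' := by
  cases c with
  | top => rfl
  | bot => rfl
  | eq s t =>
    simp only [Builtin.Holds]
    rw [realize_congr s fun x hx => h x (Or.inl hx), realize_congr t fun x hx => h x (Or.inr hx)]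
  | rel R ts =>
    simp only [Builtin.Holds]
    have : (fun i => (ts i).realize ν) = fun i => (ts i).realize ν' :=
      funext fun i => realize_congr _ fun x hx => h x (Set.mem_iUnion.2 ⟨i, hx⟩)
    rw [this]

theorem storeHolds_congr {M : Type*} [L.Structure M] {ν ν' : X → M} (B : List (Builtin L X))
    (h : ∀ x ∈ storeVars B, ν x = ν' x) : StoreHolds ν B ↔ StoreHolds ν' B :=
  forall₂_congr fun c hc => c.holds_congr fun x hx => h x ⟨c, hc, hx⟩

theorem storeHolds_append {M : Type*} [L.Structure M] {ν : X → M} (B B' : List (Builtin L X)) :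
    StoreHolds ν (B ++ B') ↔ StoreHolds ν B ∧ StoreHolds ν B' := by
  simp [StoreHolds, or_imp, forall_and]

theorem finite_termVars (t : L.Term X) : (termVars t).Finite := by
  induction t with
  | var x => exact Set.finite_singleton x
  | func f ts ih => exact Set.finite_iUnion ih

theorem UserConstraint.finite_vars (c : UserConstraint L arity X) : c.vars.Finite :=
  Set.finite_iUnion fun _ => finite_termVars _

theorem Builtin.finite_vars (c : Builtin L X) : c.vars.Finite := by
  cases c with
  | top => exact Set.finite_empty
  | bot => exact Set.finite_empty
  | eq s t => exact (finite_termVars s).union (finite_termVars t)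
  | rel R ts => exact Set.finite_iUnion fun _ => finite_termVars _

theorem finite_goalVars (G : Multiset (UserConstraint L arity X)) : (goalVars G).Finite := by
  classical
  have : goalVars G = ⋃ c ∈ {c | c ∈ G}, c.vars := by ext; simp [goalVars]
  rw [this]
  refine Set.Finite.biUnion ?_ fun c _ => c.finite_vars
  exact (Multiset.finite_toSet G)

theorem finite_storeVars (B : List (Builtin L X)) : (storeVars B).Finite := by
  have : storeVars B = ⋃ c ∈ {c | c ∈ B}, c.vars := by ext; simp [storeVars]
  rw [this]
  exact Set.Finite.biUnion (List.finite_toSet B) fun c _ => c.finite_vars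

open Classical in
/-- The substitution `[x/t]` on terms. -/
noncomputable def substTerm (x : X) (t s : L.Term X) : L.Term X :=
  s.subst fun y => if y = x then t else Term.var y

theorem substTerm_of_notMem {x : X} {t s : L.Term X} (h : x ∉ termVars s) :
    substTerm x t s = s := by
  induction s with
  | var y =>
    have : y ≠ x := fun e => h (by simp [termVars, e])
    simp [substTerm, Term.subst, this]
  | func f ts ih =>
    have : ∀ i, substTerm x t (ts i) = ts i := fun i =>
      ih i fun hx => h (Set.mem_iUnion.2 ⟨i, hx⟩)
    simp only [substTerm, Term.subst] at this ⊢
    simp [this]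

theorem substTerm_var_self (x : X) (t : L.Term X) : substTerm x t (.var x) = t := by
  simp [substTerm, Term.subst]

theorem substTerm_var_of_ne {x y : X} (h : y ≠ x) (t : L.Term X) :
    substTerm x t (.var y) = .var y := by
  simp [substTerm, Term.subst, h]

theorem realize_substTerm {M : Type*} [L.Structure M] {ν : X → M} {x : X} {t : L.Term X}
    (h : ν x = t.realize ν) (s : L.Term X) : (substTerm x t s).realize ν = s.realize ν := by
  rw [substTerm, Term.realize_subst]
  congr 1
  funext y
  split_ifs with hy
  · rw [hy, h]
  · rfl

theorem foldl_substTerm_of_disjoint (l : List (X × L.Term X)) {s : L.Term X}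
    (h : ∀ q ∈ l, q.1 ∉ termVars s) :
    l.foldl (fun s q => substTerm q.1 q.2 s) s = s := by
  induction l with
  | nil => rfl
  | cons q l ih =>
    rw [List.foldl_cons, substTerm_of_notMem (h q (by simp))]
    exact ih fun q' hq' => h q' (by simp [hq'])

/-- Successive substitutions act on `x` like the single one: pairs before the first one for `x`
leave it alone, and later pairs do not touch `t`. -/
theorem foldl_substTerm_var (l : List (X × L.Term X)) {x : X} {t : L.Term X} (hx : (x, t) ∈ l)
    (huniq : ∀ q ∈ l, q.1 = x → q.2 = t) (hdisj : ∀ q ∈ l, q.1 ∉ termVars t) :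
    l.foldl (fun s q => substTerm q.1 q.2 s) (.var x) = t := by
  induction l with
  | nil => simp at hx
  | cons q l ih =>
    rw [List.foldl_cons]
    by_cases hq : q.1 = x
    · have := huniq q (by simp) hq
      rw [hq, this, substTerm_var_self]
      exact foldl_substTerm_of_disjoint l fun q' hq' => hdisj q' (by simp [hq'])
    · rw [substTerm_var_of_ne (Ne.symm hq)]
      refine ih ?_ (fun q' hq' => huniq q' (by simp [hq'])) fun q' hq' => hdisj q' (by simp [hq'])
      rcases List.mem_cons.1 hx with h | h
      · exact absurd (by rw [← h]) hq
      · exact h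

theorem UserConstraint.subst_eq (c : UserConstraint L arity X) (x : X) (t : L.Term X) :
    c.subst x t = ⟨c.sym, fun i => substTerm x t (c.args i)⟩ := rfl

theorem UserConstraint.foldl_subst (l : List (X × L.Term X)) (c : UserConstraint L arity X) :
    l.foldl (fun c q => c.subst q.1 q.2) c =
      ⟨c.sym, fun i => l.foldl (fun s q => substTerm q.1 q.2 s) (c.args i)⟩ := by
  induction l generalizing c with
  | nil => rfl
  | cons q l ih => rw [List.foldl_cons, ih]; rfl

/-! ### Ground instances of constraints -/

/-- The ground instance of a constraint under a valuation: its symbol and the values of its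
arguments. -/
def UserConstraint.eval {M : Type*} [L.Structure M] (ν : X → M) (c : UserConstraint L arity X) :
    C × List M :=
  (c.sym, List.ofFn fun i => (c.args i).realize ν)

theorem UserConstraint.eval_congr {M : Type*} [L.Structure M] {ν ν' : X → M}
    (c : UserConstraint L arity X) (h : ∀ x ∈ c.vars, ν x = ν' x) : c.eval ν = c.eval ν' := by
  have : (fun i => (c.args i).realize ν) = fun i => (c.args i).realize ν' :=
    funext fun i => realize_congr _ fun x hx => h x (Set.mem_iUnion.2 ⟨i, hx⟩)
  simp only [UserConstraint.eval]
  rw [this]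

theorem UserConstraint.eval_subst {M : Type*} [L.Structure M] {ν : X → M} {x : X} {t : L.Term X}
    (h : ν x = t.realize ν) (c : UserConstraint L arity X) : (c.subst x t).eval ν = c.eval ν := by
  simp [UserConstraint.eval, UserConstraint.subst_eq, realize_substTerm h]

/-- The families of ground instances of the constraints `c i` under the valuations that satisfy `B`
and agree with `ν₀` on `V`. -/
def instances {ι : Type*} {M : Type*} [L.Structure M] (V : Set X) (B : List (Builtin L X))
    (c : ι → UserConstraint L arity X) (ν₀ : X → M) : Set (ι → C × List M) :=
  {g | ∃ ν : X → M, (∀ x ∈ V, ν x = ν₀ x) ∧ StoreHolds ν B ∧ g = fun i => (c i).eval ν}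

variable {TG : DirGraph.{u}}

theorem eval_nodeConstraint {M : Type*} [L.Structure M] (ν : X → M) (v : TG.V) (s t : L.Term X) :
    (nodeConstraint v s t).eval ν = (.inl v, [s.realize ν, t.realize ν]) := rfl

theorem eval_edgeConstraint {M : Type*} [L.Structure M] (ν : X → M) (e : TG.E)
    (s t₁ t₂ : L.Term X) :
    (edgeConstraint e s t₁ t₂).eval ν =
      (.inr e, [s.realize ν, t₁.realize ν, t₂.realize ν]) := rfl

theorem vars_nodeConstraint (v : TG.V) (s t : L.Term X) :
    (nodeConstraint v s t).vars = termVars s ∪ termVars t := by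
  ext x
  simp only [UserConstraint.vars, Set.mem_iUnion, Set.mem_union]
  exact (Fin.exists_fin_two (p := fun i => x ∈ termVars ((![s, t] : Fin 2 → L.Term X) i)))

theorem vars_edgeConstraint (e : TG.E) (s t₁ t₂ : L.Term X) :
    (edgeConstraint e s t₁ t₂).vars = termVars s ∪ termVars t₁ ∪ termVars t₂ := by
  ext x
  simp only [UserConstraint.vars, Set.mem_iUnion, Set.mem_union]
  refine (Fin.exists_fin_succ (P := fun i : Fin 3 => x ∈ termVars ((![s, t₁, t₂] : Fin 3 → L.Term X) i))).trans ?_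
  rw [Fin.exists_fin_two, or_assoc]
  rfl

theorem rename_nodeConstraint (ρ : X → X) (v : TG.V) (s t : L.Term X) :
    (nodeConstraint v s t).rename ρ = nodeConstraint v (s.relabel ρ) (t.relabel ρ) := by
  simp only [UserConstraint.rename, nodeConstraint]
  congr 1
  funext i
  revert i
  exact (Fin.forall_fin_two (p := fun i => ((![s, t] : Fin 2 → L.Term X) i).relabel ρ =
    (![s.relabel ρ, t.relabel ρ] : Fin 2 → L.Term X) i)).2 ⟨rfl, rfl⟩

theorem rename_edgeConstraint (ρ : X → X) (e : TG.E) (s t₁ t₂ : L.Term X) :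
    (edgeConstraint e s t₁ t₂).rename ρ =
      edgeConstraint e (s.relabel ρ) (t₁.relabel ρ) (t₂.relabel ρ) := by
  simp only [UserConstraint.rename, edgeConstraint]
  congr 1
  funext i
  revert i
  refine (Fin.forall_fin_succ (P := fun i : Fin 3 => ((![s, t₁, t₂] : Fin 3 → L.Term X) i).relabel ρ =
    (![s.relabel ρ, t₁.relabel ρ, t₂.relabel ρ] : Fin 3 → L.Term X) i)).2 ⟨rfl, ?_⟩
  exact Fin.forall_fin_two.2 ⟨rfl, rfl⟩

/-! ### Models of the constraint theory -/

namespace ConstraintTheory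

variable (CT : ConstraintTheory L)

/-- The value of the constant for an integer. -/
def val (M : Type*) [L.Structure M] (n : ℤ) : M := (CT.num n : M)

theorem realize_num {M : Type*} [L.Structure M] (ν : X → M) (n : ℤ) :
    (CT.num n).term.realize ν = CT.val M n := by
  simp [val]

theorem val_injective (M : CT.Model) : Function.Injective (CT.val M) := by
  intro m n h
  by_contra hmn
  have := (Theory.models_sentence_iff.1 (CT.num_ne m n hmn)) M
  rw [Sentence.Realize, Formula.realize_not, Formula.realize_equal] at this
  exact this (by simpa [val] using h)

theorem funMap_add (M : CT.Model) (m n : ℤ) :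
    Structure.funMap CT.add ![CT.val M m, CT.val M n] = CT.val M (m + n) := by
  have h := (Theory.models_sentence_iff.1 (CT.num_add m n)) M
  rw [Sentence.Realize, Formula.realize_equal] at h
  simpa [val] using h

theorem funMap_sub (M : CT.Model) (m n : ℤ) :
    Structure.funMap CT.sub ![CT.val M m, CT.val M n] = CT.val M (m - n) := by
  have h := (Theory.models_sentence_iff.1 (CT.num_sub m n)) M
  rw [Sentence.Realize, Formula.realize_equal] at h
  simpa [val] using h

theorem infinite_model (M : CT.Model) : Infinite M :=
  Infinite.of_injective _ (CT.val_injective M)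

theorem nonempty_model : Nonempty CT.Model := CT.complete.1

/-- The numerals already give infinitely many values. This supplies pairwise distinct identifiers
for the nodes and edges of a graph. -/
theorem exists_injective (M : CT.Model) (ι : Type*) [Finite ι] :
    ∃ f : ι → M, Function.Injective f := by
  have := CT.infinite_model M
  obtain ⟨n, ⟨e⟩⟩ := Finite.exists_equiv_fin ι
  exact ⟨fun i => Infinite.natEmbedding M (e i), fun i j h => by
    simpa [Fin.val_inj] using h⟩

end ConstraintTheory

end GTSCHR

/-! ### State equivalence and the states that represent a graph -/

namespace GTSCHR

open FirstOrder FirstOrder.Language CategoryTheory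

variable {L : FirstOrder.Language.{a, b}} {C : Type u} {arity : C → ℕ} {X : Type w}
  {TG : DirGraph.{u}} (CT : ConstraintTheory L)

/-! ### State equivalence -/

theorem equiv_of_gen {σ τ : CHRState L arity X} (h : EquivGen CT σ τ) :
    (stateSetoid CT arity X).r σ τ :=
  Relation.EqvGen.rel _ _ h

theorem equiv_trans {σ τ υ : CHRState L arity X} (h : (stateSetoid CT arity X).r σ τ)
    (h' : (stateSetoid CT arity X).r τ υ) : (stateSetoid CT arity X).r σ υ :=
  Relation.EqvGen.trans _ _ _ h h'

theorem equiv_symm {σ τ : CHRState L arity X} (h : (stateSetoid CT arity X).r σ τ) :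
    (stateSetoid CT arity X).r τ σ :=
  Relation.EqvGen.symm _ _ h

theorem cls_eq_iff {σ τ : CHRState L arity X} :
    σ.cls CT = τ.cls CT ↔ (stateSetoid CT arity X).r σ τ :=
  Quotient.eq (r := stateSetoid CT arity X)

/-- The generator wants the equation at the front of the store, so a second copy of it is prepended,
used, and removed again; the store keeps its meaning throughout. -/
theorem equiv_subst_of_mem (G : Multiset (UserConstraint L arity X)) {x : X} {t : L.Term X}
    {B : List (Builtin L X)} (V : Finset X) (h : .eq (.var x) t ∈ B) :
    (stateSetoid CT arity X).r ⟨G, B, V⟩ ⟨G.map (·.subst x t), B, V⟩ := by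
  have key : ∀ (M : CT.Model) (ν : X → M),
      StoreHolds ν (.eq (.var x) t :: B) ↔ StoreHolds ν B := by
    intro M ν
    simp only [StoreHolds, List.mem_cons, forall_eq_or_imp, and_iff_right_iff_imp]
    exact fun hB => hB _ h
  refine equiv_trans CT (equiv_of_gen CT (.transformation G B (.eq (.var x) t :: B) V ?_))
    (equiv_trans CT (equiv_of_gen CT (.substitution G x t B V))
      (equiv_of_gen CT (.transformation _ _ _ V ?_)))
  · intro M ν; simp only [ExistsHolds, key]
  · intro M ν; simp only [ExistsHolds, key]

theorem equiv_foldl_subst (l : List (X × L.Term X)) (G : Multiset (UserConstraint L arity X))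
    {B : List (Builtin L X)} (V : Finset X) (h : ∀ q ∈ l, .eq (.var q.1) q.2 ∈ B) :
    (stateSetoid CT arity X).r ⟨G, B, V⟩
      ⟨G.map fun c => l.foldl (fun c q => c.subst q.1 q.2) c, B, V⟩ := by
  induction l generalizing G with
  | nil =>
    simp only [List.foldl_nil, Multiset.map_id']
    exact (stateSetoid CT arity X).refl _
  | cons q l ih =>
    refine equiv_trans CT (equiv_subst_of_mem CT G V (h q (by simp))) ?_
    have := ih (G.map (·.subst q.1 q.2)) fun q' hq' => h q' (by simp [hq'])
    rwa [Multiset.map_map] at this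

/-- Global variables that do not occur in the rest of the state can be dropped. -/
theorem equiv_omit (G : Multiset (UserConstraint L arity X)) (B : List (Builtin L X))
    (V : Finset X) (h : ∀ x ∈ V, x ∉ goalVars G ∧ x ∉ storeVars B) :
    (stateSetoid CT arity X).r ⟨G, B, V⟩ ⟨G, B, ∅⟩ := by
  classical
  induction V using Finset.induction with
  | empty => exact (stateSetoid CT arity X).refl _
  | insert x V hx ih =>
    have hx' := h x (by simp)
    have hgen := EquivGen.omission (CT := CT) G B x V hx'.1 hx'.2
    refine equiv_trans CT (equiv_of_gen CT ?_) (ih fun y hy => h y (by simp [hy]))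
    convert hgen

/-- The constraint `s(y₀, y₁, …)`. -/
def flatConstraint (arity : C → ℕ) (s : C) (y : ℕ → X) : UserConstraint L arity X :=
  ⟨s, fun j => .var (y j)⟩

theorem vars_flatConstraint {s : C} {y : ℕ → X} {x : X} :
    x ∈ (flatConstraint (L := L) arity s y).vars ↔ ∃ j : Fin (arity s), x = y j := by
  simp only [UserConstraint.vars, Set.mem_iUnion]
  rfl

/-- All arguments of the goal can be replaced by fresh variables; the new store then describes
the ground instances of the old state. -/
theorem exists_equiv_flat {ι : Type*} [Fintype ι] (c : ι → UserConstraint L arity X)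
    (B : List (Builtin L X)) (V : Finset X) (y : ι → ℕ → X)
    (hy : ∀ i j i' j', y i j = y i' j' → i = i' ∧ j = j') (hV : ∀ i j, y i j ∉ V)
    (hc : ∀ i j k, y i j ∉ (c k).vars) (hB : ∀ i j, y i j ∉ storeVars B) :
    ∃ B' : List (Builtin L X),
      (stateSetoid CT arity X).r ⟨(Finset.univ : Finset ι).val.map c, B, V⟩
        ⟨(Finset.univ : Finset ι).val.map fun i => flatConstraint arity (c i).sym (y i), B', V⟩ ∧
      ∀ (M : CT.Model) (ν : X → M),
        ExistsHolds (↑V ∪ goalVars ((Finset.univ : Finset ι).val.map fun i =>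
          flatConstraint (L := L) arity (c i).sym (y i))) ν B' ↔
        (fun i => (flatConstraint (L := L) arity (c i).sym (y i)).eval ν) ∈
          instances (↑V) B c ν := by
  classical
  let l : List (X × L.Term X) := (Finset.univ : Finset ι).toList.flatMap fun i =>
    List.ofFn fun j : Fin (arity (c i).sym) => (y i j, (c i).args j)
  have hl : ∀ q : X × L.Term X, q ∈ l ↔ ∃ i, ∃ j : Fin (arity (c i).sym), (y i j, (c i).args j) = q := by
    intro q
    simp [l, List.mem_ofFn]
  let E : List (Builtin L X) := l.map fun q => .eq (.var q.1) q.2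
  have hE : ∀ (M : CT.Model) (ν : X → M), StoreHolds ν E ↔
      ∀ i, ∀ j : Fin (arity (c i).sym), ν (y i j) = ((c i).args j).realize ν := by
    intro M ν
    constructor
    · intro h i j
      exact h _ (List.mem_map.2 ⟨_, (hl _).2 ⟨i, j, rfl⟩, rfl⟩)
    · intro h _ hd
      obtain ⟨q, hq, rfl⟩ := List.mem_map.1 hd
      obtain ⟨i, j, rfl⟩ := (hl q).1 hq
      exact h i j
  have hE' : ∀ (M : CT.Model) (ν : X → M), StoreHolds ν E ↔
      (fun i => (flatConstraint (L := L) arity (c i).sym (y i)).eval ν) =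
        fun i => (c i).eval ν := by
    intro M ν
    rw [hE, funext_iff]
    refine forall_congr' fun i => ?_
    simp only [UserConstraint.eval, flatConstraint, Prod.mk.injEq, true_and,
      List.ofFn_inj, funext_iff, Term.realize_var]
  have hargs : ∀ i j k (m : Fin (arity (c k).sym)), y i j ∉ termVars ((c k).args m) :=
    fun i j k m h => hc i j k (Set.mem_iUnion.2 ⟨m, h⟩)
  have hgoal : ∀ x, x ∈ goalVars ((Finset.univ : Finset ι).val.map fun i =>
      flatConstraint (L := L) arity (c i).sym (y i)) ↔
      ∃ i, ∃ j : Fin (arity (c i).sym), x = y i j := by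
    intro x
    simp only [goalVars, Multiset.mem_map, Set.mem_ofPred_eq]
    constructor
    · rintro ⟨_, ⟨i, _, rfl⟩, hx⟩
      exact ⟨i, vars_flatConstraint.1 hx⟩
    · rintro ⟨i, hi⟩
      exact ⟨_, ⟨i, Finset.mem_univ _, rfl⟩, vars_flatConstraint.2 hi⟩
  refine ⟨E ++ B, ?_, ?_⟩
  -- Adding the equations `E` is conservative, since the fresh variables occur neither in `V` nor in
  -- the old goal nor in `B`. Once they are present, substituting along them turns the flat goal
  -- back into the old one, so this chain is used in reverse.
  · refine equiv_trans CT (equiv_of_gen CT (.transformation _ B (E ++ B) V ?_)) (equiv_symm CT ?_)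
    · intro M ν
      constructor
      · rintro ⟨ν', hν', hB'⟩
        let ν'' : X → M := fun x =>
          if h : ∃ i, ∃ j : Fin (arity (c i).sym), x = y i j then
            ((c h.choose).args h.choose_spec.choose).realize ν' else ν' x
        have h1 : ∀ i, ∀ j : Fin (arity (c i).sym), ν'' (y i j) = ((c i).args j).realize ν' := by
          intro i j
          have h : ∃ i', ∃ j' : Fin (arity (c i').sym), y i j = y i' j' := ⟨i, j, rfl⟩
          have hd : ν'' (y i j) = ((c h.choose).args h.choose_spec.choose).realize ν' := dif_pos h
          -- The chosen pair of indices is irrelevant, because a fresh variable determines its row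
          -- and its column.
          have aux : ∀ i' (j' : Fin (arity (c i').sym)), y i j = y i' j' →
              ((c i').args j').realize ν' = ((c i).args j).realize ν' := by
            intro i' j' hs
            obtain ⟨rfl, h3⟩ := hy _ _ _ _ hs
            rw [Fin.ext h3]
          rw [hd]
          exact aux _ _ h.choose_spec.choose_spec
        have h2 : ∀ x, (∀ i j, x ≠ y i j) → ν'' x = ν' x := by
          intro x hx
          exact dif_neg (by rintro ⟨i, j, h⟩; exact hx i j h)
        refine ⟨ν'', ?_, ?_⟩
        · intro x hx
          rw [h2, hν' x hx]
          rintro i j rfl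
          rcases hx with hx | ⟨d, hd, hx⟩
          · exact hV i j hx
          · obtain ⟨k, -, rfl⟩ := Multiset.mem_map.1 hd
            exact hc i j k hx
        · rw [storeHolds_append, hE]
          refine ⟨fun i j => ?_, (storeHolds_congr B fun x hx => ?_).2 hB'⟩
          · rw [h1]
            refine (realize_congr _ fun x hx => h2 x ?_).symm
            rintro i' j' rfl
            exact hargs _ _ _ _ hx
          · apply h2; rintro i j rfl; exact hB i j hx
      · rintro ⟨ν', hν', hB'⟩
        exact ⟨ν', hν', ((storeHolds_append _ _).1 hB').2⟩
    · have := equiv_foldl_subst CT l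
        ((Finset.univ : Finset ι).val.map fun i => flatConstraint arity (c i).sym (y i))
        (B := E ++ B) V (fun q hq => List.mem_append_left _ (List.mem_map.2 ⟨q, hq, rfl⟩))
      rw [Multiset.map_map] at this
      convert this using 2
      refine Multiset.map_congr rfl fun i _ => ?_
      rw [Function.comp_apply, UserConstraint.foldl_subst]
      have hi : (c i) = ⟨(c i).sym, (c i).args⟩ := rfl
      conv_lhs => rw [hi]
      simp only [flatConstraint]
      congr 1
      funext j
      refine (foldl_substTerm_var l ((hl _).2 ⟨i, j, rfl⟩) ?_ ?_).symm
      · intro q hq hq'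
        obtain ⟨i', j', rfl⟩ := (hl q).1 hq
        obtain ⟨rfl, h⟩ := hy _ _ _ _ hq'
        rw [Fin.ext h]
      · intro q hq
        obtain ⟨i', j', rfl⟩ := (hl q).1 hq
        exact hargs _ _ _ _
  · intro M ν
    constructor
    · rintro ⟨ν', hν', hB'⟩
      rw [storeHolds_append, hE'] at hB'
      refine ⟨ν', fun x hx => hν' x (Or.inl hx), hB'.2, ?_⟩
      rw [← hB'.1]
      funext i
      refine UserConstraint.eval_congr _ fun x hx => (hν' x (Or.inr ((hgoal x).2 ?_))).symm
      exact ⟨i, vars_flatConstraint.1 hx⟩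
    · rintro ⟨ν'', hV'', hB'', heq⟩
      -- The ground instances agree, but the valuations need not: take `ν` on the fresh variables,
      -- which the flat goal makes visible, and `ν''` on everything that `V`, `B` and the old goal
      -- mention.
      let ν' : X → M := fun x => if ∃ i j, x = y i j then ν x else ν'' x
      have h1 : ∀ i j, ν' (y i j) = ν (y i j) := fun i j => if_pos ⟨i, j, rfl⟩
      have h2 : ∀ x, (∀ i j, x ≠ y i j) → ν' x = ν'' x := by
        intro x hx
        exact if_neg (by rintro ⟨i, j, h⟩; exact hx i j h)
      refine ⟨ν', ?_, ?_⟩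
      · intro x hx
        rcases hx with hx | hx
        · rw [h2, hV'' x hx]
          rintro i j rfl
          exact hV i j hx
        · obtain ⟨i, j, rfl⟩ := (hgoal x).1 hx
          exact h1 i j
      · rw [storeHolds_append, hE']
        refine ⟨?_, (storeHolds_congr B fun x hx => ?_).2 hB''⟩
        · have e1 : (fun i => (flatConstraint (L := L) arity (c i).sym (y i)).eval ν') =
              fun i => (flatConstraint (L := L) arity (c i).sym (y i)).eval ν := by
            funext i
            refine UserConstraint.eval_congr _ fun x hx => ?_
            obtain ⟨j, rfl⟩ := vars_flatConstraint.1 hx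
            exact h1 i j
          rw [e1, heq]
          funext i
          refine UserConstraint.eval_congr _ fun x hx => (h2 x ?_).symm
          rintro i' j' rfl
          exact hc _ _ _ hx
        · apply h2; rintro i j rfl; exact hB i j hx

/-- Every index gets an infinite row of variables, so that the rows need not depend on the arities
of the constraint symbols; pairing embeds all rows into the infinite complement of `F`. -/
theorem exists_fresh [Infinite X] (ι : Type*) [Finite ι] {F : Set X} (hF : F.Finite) :
    ∃ y : ι → ℕ → X, (∀ i j i' j', y i j = y i' j' → i = i' ∧ j = j') ∧ ∀ i j, y i j ∉ F := by
  have : Infinite (Fᶜ : Set X) := hF.infinite_compl.to_subtype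
  obtain ⟨n, ⟨e⟩⟩ := Finite.exists_equiv_fin ι
  refine ⟨fun i j => (Infinite.natEmbedding (Fᶜ : Set X) (Nat.pair (e i) j)).1, ?_, ?_⟩
  · intro i j i' j' h
    have := (Infinite.natEmbedding (Fᶜ : Set X)).injective (Subtype.ext h)
    rw [Nat.pair_eq_pair] at this
    exact ⟨e.injective (Fin.ext this.1), this.2⟩
  · intro i j
    exact (Infinite.natEmbedding (Fᶜ : Set X) (Nat.pair (e i) j)).2

/-! ### States that represent a graph -/

/-- Nodes and edges of a typed graph. -/
abbrev Item (G : TypedGraph TG) : Type u := G.graph.V ⊕ G.graph.E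

/-- The ground constraints of a graph whose nodes and edges have the identifiers `x`, and whose
nodes carry the second arguments `d`. -/
def pattern {M : Type*} (G : TypedGraph TG) (x : Item G → M) (d : G.graph.V → M) :
    Item G → (TG.V ⊕ TG.E) × List M
  | .inl v => (.inl (G.type.onV v), [x (.inl v), d v])
  | .inr e => (.inr (G.type.onE e),
      [x (.inr e), x (.inl (G.graph.src e)), x (.inl (G.graph.tgt e))])

/-- The values of the node degrees of a graph. -/
noncomputable def degVal (M : Type*) [L.Structure M] (G : TypedGraph TG) (v : G.graph.V) : M :=
  CT.val M (G.graph.deg v)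

/-- `σ` represents the graph `G`: its constraints correspond to the nodes and edges of `G`, and
their ground instances are the ground encodings of `G` with arbitrary identifiers. -/
def Represents (σ : CHRState L (typeArity TG) X) (G : TypedGraph TG) : Prop :=
  ∃ c : Item G → UserConstraint L (typeArity TG) X,
    σ.goal = (Finset.univ : Finset (Item G)).val.map c ∧
    ∀ (M : CT.Model) (ν : X → M), instances (↑σ.globals) σ.store c ν =
      Set.range fun x : Item G → M => pattern G x (degVal CT M G)

variable {CT}

/-- A ground instance depends only on the goal variables, and these keep their values when the store
is exchanged. -/
theorem instances_transformation {ι : Type*} {c : ι → UserConstraint L arity X}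
    {B B' : List (Builtin L X)} {V W : Set X} {M : Type*} [L.Structure M]
    (hW : ∀ i, (c i).vars ⊆ W)
    (h : ∀ ν : X → M, ExistsHolds (V ∪ W) ν B → ExistsHolds (V ∪ W) ν B') (ν : X → M) :
    instances V B c ν ⊆ instances V B' c ν := by
  rintro _ ⟨ν', hν', hB, rfl⟩
  obtain ⟨ν'', h1, h2⟩ := h ν' ⟨ν', fun _ _ => rfl, hB⟩
  refine ⟨ν'', fun x hx => (h1 x (Or.inl hx)).trans (hν' x hx), h2, ?_⟩
  funext i
  exact UserConstraint.eval_congr _ fun x hx => (h1 x (Or.inr (hW i hx))).symm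

/-- A variable that occurs nowhere can be reset to any prescribed value without affecting the store
or the instances. -/
theorem instances_omission {ι : Type*} {c : ι → UserConstraint L arity X}
    {B : List (Builtin L X)} {V : Set X} {x : X} {M : Type*} [L.Structure M]
    (hc : ∀ i, x ∉ (c i).vars) (hB : x ∉ storeVars B) (ν : X → M) :
    instances (insert x V) B c ν = instances V B c ν := by
  classical
  apply Set.Subset.antisymm
  · rintro _ ⟨ν', hν', hB, rfl⟩
    exact ⟨ν', fun y hy => hν' y (Or.inr hy), hB, rfl⟩
  · rintro _ ⟨ν', hν', hB', rfl⟩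
    have hne : ∀ y, y ≠ x → Function.update ν' x (ν x) y = ν' y :=
      fun y hy => Function.update_of_ne hy _ _
    refine ⟨Function.update ν' x (ν x), ?_, ?_, ?_⟩
    · intro y hy
      by_cases hyx : y = x
      · subst hyx; simp
      · rw [hne y hyx, hν' y (hy.resolve_left hyx)]
    · refine (storeHolds_congr B fun y hy => hne y ?_).2 hB'
      rintro rfl; exact hB hy
    · funext i
      refine UserConstraint.eval_congr _ fun y hy => (hne y ?_).symm
      rintro rfl; exact hc i hy

theorem instances_substitution {ι : Type*} {c : ι → UserConstraint L arity X}
    {B : List (Builtin L X)} {V : Set X} {x : X} {t : L.Term X} {M : Type*} [L.Structure M]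
    (ν : X → M) :
    instances V (.eq (.var x) t :: B) (fun i => (c i).subst x t) ν =
      instances V (.eq (.var x) t :: B) c ν := by
  have key : ∀ ν' : X → M, StoreHolds ν' (.eq (.var x) t :: B) →
      (fun i => ((c i).subst x t).eval ν') = fun i => (c i).eval ν' := by
    intro ν' h
    have h0 : ν' x = t.realize ν' := h (.eq (.var x) t) (by simp)
    funext i
    exact UserConstraint.eval_subst h0 _
  ext g
  constructor
  · rintro ⟨ν', h1, h2, rfl⟩
    exact ⟨ν', h1, h2, key ν' h2⟩
  · rintro ⟨ν', h1, h2, rfl⟩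
    exact ⟨ν', h1, h2, (key ν' h2).symm⟩

theorem Represents.instances_nonempty {σ : CHRState L (typeArity TG) X} {G : TypedGraph TG}
    (h : Represents CT σ G) (M : CT.Model) : ∃ ν : X → M, StoreHolds ν σ.store := by
  obtain ⟨c, -, hc⟩ := h
  obtain ⟨m⟩ : Nonempty M := inferInstance
  have : (fun x : Item G → M => pattern G x (degVal CT M G)) (fun _ => m) ∈
    instances (↑σ.globals) σ.store c (fun _ => m) := (hc M _) ▸ Set.mem_range_self _
  obtain ⟨ν, -, hν, -⟩ := this
  exact ⟨ν, hν⟩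

theorem mem_vars_of_mem_map {ι : Type*} [Fintype ι] (c : ι → UserConstraint L arity X) (i : ι) :
    (c i).vars ⊆ goalVars ((Finset.univ : Finset ι).val.map c) :=
  fun _ hx => ⟨c i, Multiset.mem_map.2 ⟨i, Finset.mem_univ _, rfl⟩, hx⟩

theorem EquivGen.represents_iff {σ τ : CHRState L (typeArity TG) X} (h : EquivGen CT σ τ)
    (G : TypedGraph TG) : Represents CT σ G ↔ Represents CT τ G := by
  classical
  cases h with
  | substitution A x t B V =>
    constructor
    · rintro ⟨c, hA, hc⟩
      refine ⟨fun i => (c i).subst x t, ?_, fun M ν => ?_⟩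
      · simp only at hA ⊢
        rw [hA, Multiset.map_map]; rfl
      · rw [← hc M ν]; exact instances_substitution ν
    · rintro ⟨c', hA, hc⟩
      -- An indexing of the substituted goal lifts to an indexing of the original one.
      obtain ⟨c, hAc, hcc⟩ := exists_map_univ_of_map_eq hA
      obtain rfl : (fun i => (c i).subst x t) = c' := funext hcc
      exact ⟨c, hAc, fun M ν => by rw [← hc M ν]; exact (instances_substitution ν).symm⟩
  | transformation A B B' V h =>
    refine exists_congr fun c => and_congr_right fun hA => ?_
    simp only at hA
    subst hA
    refine forall₂_congr fun M ν => ?_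
    have : instances (↑V) B c ν = instances (↑V) B' c ν :=
      Set.Subset.antisymm
        (instances_transformation (mem_vars_of_mem_map c) (fun ν => (h M ν).1) ν)
        (instances_transformation (mem_vars_of_mem_map c) (fun ν => (h M ν).2) ν)
    simp only [this]
  | omission A B x V hA hB =>
    refine exists_congr fun c => and_congr_right fun hA' => ?_
    simp only at hA'
    subst hA'
    refine forall₂_congr fun M ν => ?_
    rw [← instances_omission (V := ↑V) (fun i hi => hA (mem_vars_of_mem_map c i hi)) hB ν]
    simp only [Finset.coe_insert]
  | failed A A' V =>
    -- A failed store has no ground instances, whereas every graph has at least one ground encoding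
    -- in each model. So neither state represents anything.
    obtain ⟨M⟩ := CT.nonempty_model
    constructor <;>
    · intro h
      obtain ⟨ν, hν⟩ := h.instances_nonempty M
      exact (hν .bot (by simp)).elim

theorem represents_of_equiv {σ τ : CHRState L (typeArity TG) X}
    (h : (stateSetoid CT (typeArity TG) X).r σ τ) (G : TypedGraph TG) :
    Represents CT σ G ↔ Represents CT τ G := by
  induction h with
  | rel _ _ h => exact h.represents_iff G
  | refl => rfl
  | symm _ _ _ ih => exact ih.symm
  | trans _ _ _ _ _ ih ih' => exact ih.trans ih'

/-! ### The state that encodes a graph -/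

/-- The constraint symbol of a node or an edge. -/
def itemSym (G : TypedGraph TG) : Item G → TG.V ⊕ TG.E :=
  Sum.map G.type.onV G.type.onE

/-- The store of the flat encoding of a graph. -/
noncomputable def flatStore (CT : ConstraintTheory L) (G : TypedGraph TG) (y : Item G → ℕ → X) :
    List (Builtin L X) :=
  ((Finset.univ : Finset G.graph.V).toList.map fun v =>
    .eq (.var (y (.inl v) 1)) (CT.num (G.graph.deg v)).term) ++
  (Finset.univ : Finset G.graph.E).toList.flatMap fun e =>
    [.eq (.var (y (.inr e) 1)) (.var (y (.inl (G.graph.src e)) 0)),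
      .eq (.var (y (.inr e) 2)) (.var (y (.inl (G.graph.tgt e)) 0))]

/-- The flat encoding of a graph as a state without global variables. -/
noncomputable def flatState (CT : ConstraintTheory L) (G : TypedGraph TG) (y : Item G → ℕ → X) :
    CHRState L (typeArity TG) X where
  goal := (Finset.univ : Finset (Item G)).val.map fun i =>
    flatConstraint (typeArity TG) (itemSym G i) (y i)
  store := flatStore CT G y
  globals := ∅

theorem eval_flatConstraint_node {M : Type*} [L.Structure M] (ν : X → M) (v : TG.V) (y : ℕ → X) :
    (flatConstraint (L := L) (typeArity TG) (.inl v) y).eval ν = (.inl v, [ν (y 0), ν (y 1)]) :=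
  rfl

theorem eval_flatConstraint_edge {M : Type*} [L.Structure M] (ν : X → M) (e : TG.E) (y : ℕ → X) :
    (flatConstraint (L := L) (typeArity TG) (.inr e) y).eval ν =
      (.inr e, [ν (y 0), ν (y 1), ν (y 2)]) :=
  rfl

theorem storeHolds_flatStore {M : Type*} [L.Structure M] {ν : X → M} (G : TypedGraph TG)
    (y : Item G → ℕ → X) :
    StoreHolds ν (flatStore CT G y) ↔
      (fun i => (flatConstraint (L := L) (typeArity TG) (itemSym G i) (y i)).eval ν) =
        pattern G (fun i => ν (y i 0)) (degVal CT M G) := by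
  rw [flatStore, storeHolds_append]
  simp only [funext_iff, Sum.forall, itemSym, Sum.map_inl, Sum.map_inr, eval_flatConstraint_node,
    eval_flatConstraint_edge, pattern, degVal, StoreHolds]
  refine and_congr ?_ ?_
  · simp only [List.mem_map, Finset.mem_toList, Finset.mem_univ, true_and, forall_exists_index,
      forall_apply_eq_imp_iff]
    refine forall_congr' fun v => ?_
    simp [Builtin.Holds, ConstraintTheory.val]
  · simp only [List.mem_flatMap, Finset.mem_toList, Finset.mem_univ, true_and, forall_exists_index]
    rw [forall_comm]
    refine forall_congr' fun e => ?_
    simp [Builtin.Holds]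

theorem storeVars_flatStore (G : TypedGraph TG) (y : Item G → ℕ → X) {x : X}
    (hx : x ∈ storeVars (flatStore CT G y)) : ∃ i j, x = y i j := by
  obtain ⟨c, hc, hx⟩ := hx
  have hnum : ∀ n, termVars (CT.num n).term = (∅ : Set X) := by
    intro n
    exact Set.iUnion_of_empty _
  rcases List.mem_append.1 hc with h | h
  · obtain ⟨v, -, rfl⟩ := List.mem_map.1 h
    simp only [Builtin.vars, hnum, Set.union_empty] at hx
    exact ⟨_, _, hx⟩
  · obtain ⟨e, -, h⟩ := List.mem_flatMap.1 h
    simp only [List.mem_cons, List.not_mem_nil, or_false] at h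
    rcases h with rfl | rfl
    · rcases hx with hx | hx
      · exact ⟨_, _, hx⟩
      · exact ⟨_, _, hx⟩
    · rcases hx with hx | hx
      · exact ⟨_, _, hx⟩
      · exact ⟨_, _, hx⟩

/-- A representation of `G` is equivalent to the flat encoding of `G` over fresh variables. -/
theorem Represents.equiv_flatState {σ : CHRState L (typeArity TG) X} {G : TypedGraph TG}
    (h : Represents CT σ G) (y : Item G → ℕ → X)
    (hy : ∀ i j i' j', y i j = y i' j' → i = i' ∧ j = j')
    (hfresh : ∀ i j, y i j ∉ (↑σ.globals ∪ goalVars σ.goal ∪ storeVars σ.store : Set X)) :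
    (stateSetoid CT (typeArity TG) X).r σ (flatState CT G y) := by
  obtain ⟨A, B, V⟩ := σ
  obtain ⟨c, hA, hc⟩ := h
  simp only at hA hc hfresh
  subst hA
  obtain ⟨B', h1, h2⟩ := exists_equiv_flat CT c B V y hy
    (fun i j hx => hfresh i j (Or.inl (Or.inl hx)))
    (fun i j k hx => hfresh i j (Or.inl (Or.inr (mem_vars_of_mem_map c k hx))))
    (fun i j hx => hfresh i j (Or.inr hx))
  -- The symbols do not depend on the valuation, so a single instance in a single model reveals
  -- them.
  have hsym : ∀ i, (c i).sym = itemSym G i := by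
    obtain ⟨M⟩ := CT.nonempty_model
    obtain ⟨m⟩ : Nonempty M := inferInstance
    have : pattern G (fun _ => m) (degVal CT M G) ∈ instances (↑V) B c (fun _ => m) :=
      (hc M _) ▸ ⟨fun _ => m, rfl⟩
    obtain ⟨ν, -, -, heq⟩ := this
    intro i
    have := congrArg Prod.fst (congrFun heq i)
    cases i with
    | inl v => exact this.symm
    | inr e => exact this.symm
  simp only [hsym] at h1 h2
  -- After flattening, `B'` and the flat store allow the same ground instances, hence are
  -- interchangeable. As these instances do not depend on the values of `V`, the global variables
  -- are then absent from the state and can be dropped.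
  refine equiv_trans CT h1 (equiv_trans CT
    (equiv_of_gen CT (.transformation _ B' (flatStore CT G y) V ?_)) (equiv_omit CT _ _ V ?_))
  · intro M ν
    rw [h2, hc]
    have hvar : ∀ i j, j < typeArity TG (itemSym G i) → y i j ∈
        goalVars ((Finset.univ : Finset (Item G)).val.map fun i =>
          flatConstraint (L := L) (typeArity TG) (itemSym G i) (y i)) := fun i j hj =>
      mem_vars_of_mem_map _ i (vars_flatConstraint.2 ⟨⟨j, hj⟩, rfl⟩)
    constructor
    · rintro ⟨x, hx⟩
      refine ⟨ν, fun _ _ => rfl, (storeHolds_flatStore G y).2 ?_⟩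
      simp only at hx
      rw [← hx]
      congr 1
      funext i
      have := congrFun hx i
      rcases i with v | e
      · simp only [pattern, itemSym, Sum.map_inl, eval_flatConstraint_node, Prod.mk.injEq,
          List.cons.injEq] at this
        exact this.2.1
      · simp only [pattern, itemSym, Sum.map_inr, eval_flatConstraint_edge, Prod.mk.injEq,
          List.cons.injEq] at this
        exact this.2.1
    · rintro ⟨ν', hν', hB'⟩
      refine ⟨fun i => ν' (y i 0), ?_⟩
      rw [storeHolds_flatStore] at hB'
      simp only
      rw [← hB']
      funext i
      refine UserConstraint.eval_congr _ fun x hx => ?_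
      obtain ⟨j, rfl⟩ := vars_flatConstraint.1 hx
      exact hν' _ (Or.inr (hvar i j j.2))
  · intro x hx
    have hne : ¬ ∃ i j, x = y i j := by
      rintro ⟨i, j, rfl⟩
      exact hfresh i j (Or.inl (Or.inl hx))
    refine ⟨?_, fun h => hne (storeVars_flatStore G y h)⟩
    rintro ⟨d, hd, hx⟩
    obtain ⟨i, -, rfl⟩ := Multiset.mem_map.1 hd
    obtain ⟨j, rfl⟩ := vars_flatConstraint.1 hx
    exact hne ⟨_, _, rfl⟩

theorem finite_stateVars (σ : CHRState L arity X) :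
    (↑σ.globals ∪ goalVars σ.goal ∪ storeVars σ.store : Set X).Finite :=
  ((Finset.finite_toSet _).union (finite_goalVars _)).union (finite_storeVars _)

/-- Variables fresh for both states at once make the two flat encodings literally the same state. -/
theorem Represents.equiv [Infinite X] {σ τ : CHRState L (typeArity TG) X} {G : TypedGraph TG}
    (hσ : Represents CT σ G) (hτ : Represents CT τ G) :
    (stateSetoid CT (typeArity TG) X).r σ τ := by
  obtain ⟨y, hy, hfresh⟩ := exists_fresh (Item G) ((finite_stateVars σ).union (finite_stateVars τ))
  exact equiv_trans CT (hσ.equiv_flatState y hy fun i j h => hfresh i j (Or.inl h))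
    (equiv_symm CT (hτ.equiv_flatState y hy fun i j h => hfresh i j (Or.inr h)))

theorem represents_flatState (G : TypedGraph TG) (y : Item G → ℕ → X)
    (hy : ∀ i j i' j', y i j = y i' j' → i = i' ∧ j = j') :
    Represents CT (flatState CT G y) G := by
  classical
  refine ⟨fun i => flatConstraint (typeArity TG) (itemSym G i) (y i), rfl, fun M ν₀ => ?_⟩
  apply Set.Subset.antisymm
  · rintro _ ⟨ν, -, hB, rfl⟩
    exact ⟨_, ((storeHolds_flatStore G y).1 hB).symm⟩
  · rintro _ ⟨x, rfl⟩
    -- Column 0 holds identifiers, column 1 the degree of a node or the source of an edge, column 2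
    -- the target of an edge. The remaining positions lie beyond the arities, and their value is
    -- immaterial.
    let args : Item G × ℕ → M := fun q => match q with
      | (.inl v, 1) => degVal CT M G v
      | (.inr e, 1) => x (.inl (G.graph.src e))
      | (.inr e, 2) => x (.inl (G.graph.tgt e))
      | (i, _) => x i
    have hinj : Function.Injective fun q : Item G × ℕ => y q.1 q.2 := by
      intro q q' h
      exact Prod.ext (hy _ _ _ _ h).1 (hy _ _ _ _ h).2
    let ν : X → M := Function.extend (fun q : Item G × ℕ => y q.1 q.2) args ν₀
    have hν : ∀ i j, ν (y i j) = args (i, j) := fun i j => hinj.extend_apply args ν₀ (i, j)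
    have key : (fun i => (flatConstraint (L := L) (typeArity TG) (itemSym G i) (y i)).eval ν) =
        pattern G x (degVal CT M G) := by
      funext i
      rcases i with v | e
      · simp only [itemSym, Sum.map_inl, eval_flatConstraint_node, pattern, hν]
        rfl
      · simp only [itemSym, Sum.map_inr, eval_flatConstraint_edge, pattern, hν]
        rfl
    refine ⟨ν, fun x hx => absurd hx (Finset.notMem_empty x), ?_, key.symm⟩
    rw [flatState, storeHolds_flatStore, key]
    congr 1
    funext i
    rw [hν]
    rcases i with v | e <;> rfl

theorem exists_represents [Infinite X] (CT : ConstraintTheory L) (G : TypedGraph TG) :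
    ∃ σ : CHRState L (typeArity TG) X, Represents CT σ G := by
  obtain ⟨y, hy, -⟩ := exists_fresh (X := X) (Item G) Set.finite_empty
  exact ⟨_, represents_flatState G y hy⟩

end GTSCHR

/-! ### Typed graphs: pushouts, the dangling condition, degrees, the result of a rule -/

namespace GTSCHR

open FirstOrder FirstOrder.Language CategoryTheory

variable {TG : DirGraph.{u}}

/-! ### Morphisms of typed graphs -/

theorem hom_ext {G H : TypedGraph TG} {f g : G ⟶ H} (hV : ∀ v, f.onV v = g.onV v)
    (hE : ∀ e, f.onE e = g.onE e) : f = g :=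
  TypedGraph.Hom.ext (funext hV) (funext hE)

theorem comp_onV {G H K : TypedGraph TG} (f : G ⟶ H) (g : H ⟶ K) (v : G.graph.V) :
    (f ≫ g).onV v = g.onV (f.onV v) := rfl

theorem comp_onE {G H K : TypedGraph TG} (f : G ⟶ H) (g : H ⟶ K) (e : G.graph.E) :
    (f ≫ g).onE e = g.onE (f.onE e) := rfl

theorem nonempty_iso_of_bijective {G H : TypedGraph TG} (f : G ⟶ H)
    (hV : Function.Bijective f.onV) (hE : Function.Bijective f.onE) : Nonempty (G ≅ H) := by
  let eV := Equiv.ofBijective f.onV hV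
  let eE := Equiv.ofBijective f.onE hE
  have h1 : ∀ v, f.onV (eV.symm v) = v := eV.apply_symm_apply
  have h2 : ∀ e, f.onE (eE.symm e) = e := eE.apply_symm_apply
  let g : H ⟶ G :=
    { onV := eV.symm
      onE := eE.symm
      src_comm := fun e => hV.1 (by rw [h1, f.src_comm, h2])
      tgt_comm := fun e => hV.1 (by rw [h1, f.tgt_comm, h2])
      typeV_comm := fun v => by rw [← f.typeV_comm, h1]
      typeE_comm := fun e => by rw [← f.typeE_comm, h2] }
  exact ⟨f, g, hom_ext (fun v => eV.symm_apply_apply v) (fun e => eE.symm_apply_apply e),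
    hom_ext h1 h2⟩

/-- A map of items that is compatible with ground encodings, the second of them with distinct
identifiers, comes from a morphism of typed graphs. -/
theorem exists_hom_of_pattern {A G : TypedGraph TG} {M : Type*} {x : Item A → M}
    {d : A.graph.V → M} {z : Item G → M} {d' : G.graph.V → M} (hz : Function.Injective z)
    (μ : Item A → Item G) (h : ∀ i, pattern A x d i = pattern G z d' (μ i)) :
    ∃ m : A ⟶ G, (∀ v, μ (.inl v) = .inl (m.onV v)) ∧ ∀ e, μ (.inr e) = .inr (m.onE e) := by
  have hV : ∀ v, ∃ v', μ (.inl v) = .inl v' := by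
    intro v
    have := congrArg Prod.fst (h (.inl v))
    rcases hv : μ (.inl v) with v' | e'
    · exact ⟨v', rfl⟩
    · rw [hv] at this; simp [pattern] at this
  have hE : ∀ e, ∃ e', μ (.inr e) = .inr e' := by
    intro e
    have := congrArg Prod.fst (h (.inr e))
    rcases he : μ (.inr e) with v' | e'
    · rw [he] at this; simp [pattern] at this
    · exact ⟨e', rfl⟩
  choose mV hmV using hV
  choose mE hmE using hE
  have h1 : ∀ v, A.type.onV v = G.type.onV (mV v) ∧ x (.inl v) = z (.inl (mV v)) := by
    intro v
    have := h (.inl v)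
    rw [hmV] at this
    simp only [pattern, Prod.mk.injEq, Sum.inl.injEq, List.cons.injEq] at this
    exact ⟨this.1, this.2.1⟩
  have h2 : ∀ e, A.type.onE e = G.type.onE (mE e) ∧
      x (.inl (A.graph.src e)) = z (.inl (G.graph.src (mE e))) ∧
      x (.inl (A.graph.tgt e)) = z (.inl (G.graph.tgt (mE e))) := by
    intro e
    have := h (.inr e)
    rw [hmE] at this
    simp only [pattern, Prod.mk.injEq, Sum.inr.injEq, List.cons.injEq] at this
    exact ⟨this.1, this.2.2.1, this.2.2.2.1⟩
  exact ⟨{  onV := mV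
            onE := mE
            src_comm := fun e => Sum.inl_injective (hz ((h1 _).2.symm.trans (h2 e).2.1))
            tgt_comm := fun e => Sum.inl_injective (hz ((h1 _).2.symm.trans (h2 e).2.2))
            typeV_comm := fun v => (h1 v).1.symm
            typeE_comm := fun e => (h2 e).1.symm }, hmV, hmE⟩

/-- A state represents at most one graph up to isomorphism. -/
theorem Represents.nonempty_iso {L : FirstOrder.Language.{a, b}} {X : Type w}
    {CT : ConstraintTheory L} {σ : CHRState L (typeArity TG) X} {G H : TypedGraph TG}
    (hG : Represents CT σ G) (hH : Represents CT σ H) : Nonempty (G ≅ H) := by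
  obtain ⟨c, hc, hcG⟩ := hG
  obtain ⟨d, hd, hdH⟩ := hH
  obtain ⟨μ, hμ⟩ := exists_equiv_of_map_univ_eq (hc.symm.trans hd)
  obtain ⟨M⟩ := CT.nonempty_model
  obtain ⟨m⟩ : Nonempty M := inferInstance
  -- Distinct identifiers allow the endpoints of the edges of `H` to be recovered from one instance.
  -- The same valuation, read through the indexing by `G`, is a ground encoding of `G`; comparing
  -- the two turns the bijection `μ` into a morphism.
  obtain ⟨z, hz⟩ := CT.exists_injective M (Item H)
  have : pattern H z (degVal CT M H) ∈ instances (↑σ.globals) σ.store d (fun _ => m) :=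
    (hdH M _) ▸ ⟨z, rfl⟩
  obtain ⟨ν, h1, h2, h3⟩ := this
  have h4 : (fun i => (c i).eval ν) ∈ instances (↑σ.globals) σ.store c (fun _ => m) :=
    ⟨ν, h1, h2, rfl⟩
  rw [hcG M] at h4
  obtain ⟨x, hx⟩ := h4
  obtain ⟨f, hfV, hfE⟩ := exists_hom_of_pattern hz μ (x := x) (d := degVal CT M G) fun i => by
    rw [h3]
    exact (congrFun hx i).trans (by rw [← hμ i])
  refine nonempty_iso_of_bijective f ⟨?_, ?_⟩ ⟨?_, ?_⟩
  · intro v v' h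
    have := (hfV v).trans ((congrArg Sum.inl h).trans (hfV v').symm)
    exact Sum.inl_injective (μ.injective this)
  · intro v
    obtain ⟨i, hi⟩ := μ.surjective (.inl v)
    rcases i with v' | e'
    · exact ⟨v', Sum.inl_injective ((hfV v').symm.trans hi)⟩
    · rw [hfE] at hi; cases hi
  · intro v v' h
    have := (hfE v).trans ((congrArg Sum.inr h).trans (hfE v').symm)
    exact Sum.inr_injective (μ.injective this)
  · intro v
    obtain ⟨i, hi⟩ := μ.surjective (.inr v)
    rcases i with v' | e'
    · rw [hfV] at hi; cases hi
    · exact ⟨e', Sum.inr_injective ((hfE e').symm.trans hi)⟩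

/-! ### Pushouts of typed graphs -/

/-- Gluing of functions: the images of `m` and `f` cover `G`, and a point in both images comes from
a single point of `K`, where the two prescriptions agree. -/
theorem exists_desc {K L D G Z : Type*} {l : K → L} {k : K → D} {m : L → G} {f : D → G}
    (comm : ∀ x, m (l x) = f (k x)) (hm : Function.Injective m) (hf : Function.Injective f)
    (hover : ∀ x d, m x = f d → x ∈ Set.range l) (hsurj : ∀ y, y ∈ Set.range m ∨ y ∈ Set.range f)
    (h₁ : L → Z) (h₂ : D → Z) (h : ∀ x, h₁ (l x) = h₂ (k x)) :
    ∃ g : G → Z, (∀ x, g (m x) = h₁ x) ∧ ∀ d, g (f d) = h₂ d := by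
  have key : ∀ y, ∃ z, (∀ x, m x = y → z = h₁ x) ∧ ∀ d, f d = y → z = h₂ d := by
    have hmix : ∀ x d, m x = f d → h₁ x = h₂ d := by
      intro x d hxd
      obtain ⟨κ, rfl⟩ := hover x d hxd
      rw [h, hf ((comm κ).symm.trans hxd)]
    intro y
    rcases hsurj y with ⟨x, rfl⟩ | ⟨d, rfl⟩
    · exact ⟨h₁ x, fun x' hx' => by rw [hm hx'], fun d hd => hmix x d hd.symm⟩
    · exact ⟨h₂ d, fun x hx => (hmix x d hx).symm, fun d' hd' => by rw [hf hd']⟩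
  choose g hg hg' using key
  exact ⟨g, fun x => hg _ x rfl, fun d => hg' _ d rfl⟩

/-- Nodes and edges are glued separately as sets. Compatibility with sources, targets and types, as
well as uniqueness, can be checked on the two images because they cover `G`. -/
theorem isPushout_of_injective {K L D G : TypedGraph TG} {l : K ⟶ L} {k : K ⟶ D} {m : L ⟶ G}
    {f : D ⟶ G} (comm : l ≫ m = k ≫ f)
    (hmV : Function.Injective m.onV) (hmE : Function.Injective m.onE)
    (hfV : Function.Injective f.onV) (hfE : Function.Injective f.onE)
    (hoverV : ∀ x d, m.onV x = f.onV d → x ∈ Set.range l.onV)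
    (hoverE : ∀ x d, m.onE x = f.onE d → x ∈ Set.range l.onE)
    (hsurjV : ∀ y, y ∈ Set.range m.onV ∨ y ∈ Set.range f.onV)
    (hsurjE : ∀ y, y ∈ Set.range m.onE ∨ y ∈ Set.range f.onE) : IsPushout l k m f := by
  have hcV : ∀ v, m.onV (l.onV v) = f.onV (k.onV v) := fun v => by
    rw [← comp_onV, comm, comp_onV]
  have hcE : ∀ v, m.onE (l.onE v) = f.onE (k.onE v) := fun v => by
    rw [← comp_onE, comm, comp_onE]
  have key : ∀ s : Limits.PushoutCocone l k, ∃ g : G ⟶ s.pt, m ≫ g = s.inl ∧ f ≫ g = s.inr := by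
    intro s
    have hs : l ≫ s.inl = k ≫ s.inr := s.condition
    obtain ⟨gV, hV1, hV2⟩ := exists_desc hcV hmV hfV hoverV hsurjV s.inl.onV s.inr.onV
      (fun v => by rw [← comp_onV, hs, comp_onV])
    obtain ⟨gE, hE1, hE2⟩ := exists_desc hcE hmE hfE hoverE hsurjE s.inl.onE s.inr.onE
      (fun v => by rw [← comp_onE, hs, comp_onE])
    refine ⟨{ onV := gV, onE := gE, src_comm := fun e => ?_, tgt_comm := fun e => ?_
              typeV_comm := fun v => ?_, typeE_comm := fun e => ?_ },
      hom_ext hV1 hE1, hom_ext hV2 hE2⟩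
    · rcases hsurjE e with ⟨x, rfl⟩ | ⟨x, rfl⟩
      · rw [← m.src_comm, hV1, hE1, s.inl.src_comm]
      · rw [← f.src_comm, hV2, hE2, s.inr.src_comm]
    · rcases hsurjE e with ⟨x, rfl⟩ | ⟨x, rfl⟩
      · rw [← m.tgt_comm, hV1, hE1, s.inl.tgt_comm]
      · rw [← f.tgt_comm, hV2, hE2, s.inr.tgt_comm]
    · rcases hsurjV v with ⟨x, rfl⟩ | ⟨x, rfl⟩
      · rw [hV1, m.typeV_comm]; exact s.inl.typeV_comm x
      · rw [hV2, f.typeV_comm]; exact s.inr.typeV_comm x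
    · rcases hsurjE e with ⟨x, rfl⟩ | ⟨x, rfl⟩
      · rw [hE1, m.typeE_comm]; exact s.inl.typeE_comm x
      · rw [hE2, f.typeE_comm]; exact s.inr.typeE_comm x
  choose g hg1 hg2 using key
  refine ⟨⟨comm⟩, ⟨Limits.PushoutCocone.IsColimit.mk comm g hg1 hg2 ?_⟩⟩
  intro s g' h1 h2
  refine hom_ext (fun v => ?_) (fun e => ?_)
  · rcases hsurjV v with ⟨x, rfl⟩ | ⟨x, rfl⟩
    · rw [← comp_onV, ← comp_onV, h1, hg1]
    · rw [← comp_onV, ← comp_onV, h2, hg2]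
  · rcases hsurjE e with ⟨x, rfl⟩ | ⟨x, rfl⟩
    · rw [← comp_onE, ← comp_onE, h1, hg1]
    · rw [← comp_onE, ← comp_onE, h2, hg2]

/-- The typed graph whose incoming morphisms are the Boolean labellings of the nodes. -/
def nodeLabelGraph (TG : DirGraph.{u}) : TypedGraph TG where
  graph :=
    { V := TG.V × Bool
      E := TG.E × Bool × Bool
      src := fun e => (TG.src e.1, e.2.1)
      tgt := fun e => (TG.tgt e.1, e.2.2) }
  type :=
    { onV := Prod.fst, onE := Prod.fst, src_comm := fun _ => rfl, tgt_comm := fun _ => rfl }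

/-- The morphism for a Boolean labelling of the nodes. -/
def nodeLabelHom (G : TypedGraph TG) (f : G.graph.V → Bool) : G ⟶ nodeLabelGraph TG where
  onV v := (G.type.onV v, f v)
  onE e := (G.type.onE e, f (G.graph.src e), f (G.graph.tgt e))
  src_comm e := Prod.ext (G.type.src_comm e) rfl
  tgt_comm e := Prod.ext (G.type.tgt_comm e) rfl
  typeV_comm _ := rfl
  typeE_comm _ := rfl

/-- The typed graph whose incoming morphisms are the Boolean labellings of the edges. -/
def edgeLabelGraph (TG : DirGraph.{u}) : TypedGraph TG where
  graph :=
    { V := TG.V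
      E := TG.E × Bool
      src := fun e => TG.src e.1
      tgt := fun e => TG.tgt e.1 }
  type :=
    { onV := id, onE := Prod.fst, src_comm := fun _ => rfl, tgt_comm := fun _ => rfl }

/-- The morphism for a Boolean labelling of the edges. -/
def edgeLabelHom (G : TypedGraph TG) (f : G.graph.E → Bool) : G ⟶ edgeLabelGraph TG where
  onV v := G.type.onV v
  onE e := (G.type.onE e, f e)
  src_comm e := G.type.src_comm e
  tgt_comm e := G.type.tgt_comm e
  typeV_comm _ := rfl
  typeE_comm _ := rfl

section Pushout

variable {K L D G : TypedGraph TG} {l : K ⟶ L} {k : K ⟶ D} {m : L ⟶ G} {f : D ⟶ G}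

/-- Were `v` outside the image of `l`, labelling `v` alone true on `L` and everything false on `D`
would be consistent on `K`. The induced labelling of `G` would then give the common image of `v` and
`d` both labels. -/
theorem mem_range_of_isPushout (h : IsPushout l k m f) {v : L.graph.V} {d : D.graph.V}
    (hvd : m.onV v = f.onV d) : v ∈ Set.range l.onV := by
  classical
  by_contra hv
  let h₁ := nodeLabelHom L fun x => decide (x = v)
  let h₂ := nodeLabelHom D fun _ => false
  have hcomm : l ≫ h₁ = k ≫ h₂ := by
    have hne : ∀ x, l.onV x ≠ v := fun x hx => hv ⟨x, hx⟩
    refine hom_ext (fun x => ?_) (fun e => ?_)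
    · refine Prod.ext ((l.typeV_comm x).trans (k.typeV_comm x).symm) ?_
      exact decide_eq_false (hne x)
    · refine Prod.ext ((l.typeE_comm e).trans (k.typeE_comm e).symm) ?_
      refine Prod.ext (decide_eq_false ?_) (decide_eq_false ?_)
      · rw [← l.src_comm]; exact hne _
      · rw [← l.tgt_comm]; exact hne _
  have e1 : (h.desc h₁ h₂ hcomm).onV (m.onV v) = h₁.onV v := by
    rw [← comp_onV, h.inl_desc]
  have e2 : (h.desc h₁ h₂ hcomm).onV (f.onV d) = h₂.onV d := by
    rw [← comp_onV, h.inr_desc]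
  rw [hvd, e2] at e1
  have := congrArg Prod.snd e1
  simp [h₁, h₂, nodeLabelHom] at this

/-- If `e` came from neither side, the labelling marking `e` alone and the one marking nothing would
agree on `L` and on `D`, against uniqueness in the pushout property. -/
theorem edge_mem_range_of_isPushout (h : IsPushout l k m f) (e : G.graph.E) :
    e ∈ Set.range m.onE ∨ e ∈ Set.range f.onE := by
  classical
  by_contra hcon
  push Not at hcon
  have : edgeLabelHom G (fun e' => decide (e' = e)) = edgeLabelHom G fun _ => false := by
    refine h.hom_ext (hom_ext (fun _ => rfl) fun x => ?_) (hom_ext (fun _ => rfl) fun x => ?_)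
    · exact Prod.ext rfl (decide_eq_false fun hx => hcon.1 ⟨x, hx⟩)
    · exact Prod.ext rfl (decide_eq_false fun hx => hcon.2 ⟨x, hx⟩)
  have h2 : (edgeLabelHom G (fun e' => decide (e' = e))).onE e =
    (edgeLabelHom G fun _ => false).onE e := by rw [this]
  have := congrArg Prod.snd h2
  simp [edgeLabelHom] at this

end Pushout

/-! ### Matches and degrees -/

/-- The dangling condition for a match `m` of the left-hand side of a rule. -/
def NoDangling (p : ProdRule TG) {G : TypedGraph TG} (m : p.L ⟶ G) : Prop :=
  ∀ v ∉ Set.range p.l.onV, ∀ e, G.graph.src e = m.onV v ∨ G.graph.tgt e = m.onV v →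
    e ∈ Set.range m.onE

/-- An edge outside the match comes from `D`, and so do its endpoints; a matched node that also
comes from `D` lies in `K`. This is all that completeness needs to know about an arbitrary double
pushout. -/
theorem DirectDerivation.noDangling {p : ProdRule TG} {G H : TypedGraph TG} {m : p.L ⟶ G}
    (h : DirectDerivation p G H m) : NoDangling p m := by
  obtain ⟨-, -, D, k, f, -, -, hpo, -⟩ := h
  rintro v hv e he
  rcases edge_mem_range_of_isPushout hpo e with h | ⟨d, rfl⟩
  · exact h
  · rw [← f.src_comm, ← f.tgt_comm] at he
    rcases he with he | he
    · exact absurd (mem_range_of_isPushout hpo he.symm) hv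
    · exact absurd (mem_range_of_isPushout hpo he.symm) hv

open Classical in
/-- The number of ends of the edge `e` at the node `v`. -/
noncomputable def ends {V : Type*} (s t v : V) : ℕ :=
  (if s = v then 1 else 0) + if t = v then 1 else 0

theorem ends_map {V W : Type*} {f : V → W} (hf : Function.Injective f) (s t v : V) :
    ends (f s) (f t) (f v) = ends s t v := by
  classical
  unfold ends
  congr 1 <;> exact if_congr hf.eq_iff rfl rfl

theorem ends_eq_zero {V : Type*} {s t v : V} : ends s t v = 0 ↔ s ≠ v ∧ t ≠ v := by
  simp [ends]

theorem deg_eq_sum (G : DirGraph.{u}) (v : G.V) :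
    G.deg v = ∑ e, ends (G.src e) (G.tgt e) v := by
  classical
  simp only [ends, Finset.sum_add_distrib, ← Finset.card_filter, DirGraph.deg]

open Classical in
theorem sum_eq_sum_range_add {α β : Type*} [Fintype α] [Fintype β] {m : α → β}
    (hm : Function.Injective m) (f : β → ℕ) :
    ∑ y, f y = ∑ x, f (m x) + ∑ y : {y // y ∉ Set.range m}, f y := by
  rw [← Fintype.sum_subtype_add_sum_subtype (fun y => y ∈ Set.range m) f]
  congr 1
  convert (Fintype.sum_equiv (Equiv.ofInjective m hm) (fun x => f (m x)) (fun y => f y.1)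
    fun x => rfl).symm

open Classical in
theorem deg_hom {A G : TypedGraph TG} {m : A ⟶ G} (hV : Function.Injective m.onV)
    (hE : Function.Injective m.onE) (v : A.graph.V) :
    G.graph.deg (m.onV v) = A.graph.deg v +
      ∑ e : {e // e ∉ Set.range m.onE}, ends (G.graph.src e) (G.graph.tgt e) (m.onV v) := by
  rw [deg_eq_sum, deg_eq_sum, sum_eq_sum_range_add hE]
  congr 1
  refine Finset.sum_congr rfl fun e _ => ?_
  rw [← m.src_comm, ← m.tgt_comm, ends_map hV]

open Classical in
theorem deg_of_notMem_range {A G : TypedGraph TG} {m : A ⟶ G}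
    (hE : Function.Injective m.onE) {v : G.graph.V} (hv : v ∉ Set.range m.onV) :
    G.graph.deg v =
      ∑ e : {e // e ∉ Set.range m.onE}, ends (G.graph.src e) (G.graph.tgt e) v := by
  rw [deg_eq_sum, sum_eq_sum_range_add hE, add_eq_right]
  refine Finset.sum_eq_zero fun e _ => ?_
  rw [← m.src_comm, ← m.tgt_comm, ends_eq_zero]
  exact ⟨fun h => hv ⟨_, h⟩, fun h => hv ⟨_, h⟩⟩

/-- The degree of `m v` in `G` is the degree of `v` in `L` plus the number of edge ends at `m v`
outside the match. Equality means that each of these contributions vanishes. -/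
theorem noDangling_iff_deg {p : ProdRule TG} {G : TypedGraph TG} {m : p.L ⟶ G}
    (hV : Function.Injective m.onV) (hE : Function.Injective m.onE) :
    NoDangling p m ↔ ∀ v ∉ Set.range p.l.onV, G.graph.deg (m.onV v) = p.L.graph.deg v := by
  classical
  refine forall₂_congr fun v _ => ?_
  rw [deg_hom hV hE, add_eq_left, Finset.sum_eq_zero_iff]
  simp only [Finset.mem_univ, true_imp_iff, ends_eq_zero, Subtype.forall]
  refine forall_congr' fun e => ?_
  tauto

/-! ### Extending a graph by nodes and edges -/

/-- The graph `A` with additional nodes `V` and edges `E`. -/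
def extend (A : TypedGraph TG) {V E : Type u} [Fintype V] [Fintype E]
    (s t : E → A.graph.V ⊕ V) (τV : V → TG.V) (τE : E → TG.E)
    (hs : ∀ e, Sum.elim A.type.onV τV (s e) = TG.src (τE e))
    (ht : ∀ e, Sum.elim A.type.onV τV (t e) = TG.tgt (τE e)) : TypedGraph TG where
  graph :=
    { V := A.graph.V ⊕ V
      E := A.graph.E ⊕ E
      src := Sum.elim (fun e => .inl (A.graph.src e)) s
      tgt := Sum.elim (fun e => .inl (A.graph.tgt e)) t }
  type :=
    { onV := Sum.elim A.type.onV τV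
      onE := Sum.elim A.type.onE τE
      src_comm := by
        rintro (e | e)
        · exact A.type.src_comm e
        · exact hs e
      tgt_comm := by
        rintro (e | e)
        · exact A.type.tgt_comm e
        · exact ht e }

section Extend

variable (A : TypedGraph TG) {V E : Type u} [Fintype V] [Fintype E]
  (s t : E → A.graph.V ⊕ V) (τV : V → TG.V) (τE : E → TG.E)
  (hs : ∀ e, Sum.elim A.type.onV τV (s e) = TG.src (τE e))
  (ht : ∀ e, Sum.elim A.type.onV τV (t e) = TG.tgt (τE e))

/-- The inclusion of a graph into an extension. -/
def extendInl : A ⟶ extend A s t τV τE hs ht where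
  onV := Sum.inl
  onE := Sum.inl
  src_comm _ := rfl
  tgt_comm _ := rfl
  typeV_comm _ := rfl
  typeE_comm _ := rfl

theorem deg_extend_inl (v : A.graph.V) :
    (extend A s t τV τE hs ht).graph.deg (.inl v) =
      A.graph.deg v + ∑ e, ends (s e) (t e) (.inl v) := by
  refine (deg_eq_sum _ _).trans
    ((Fintype.sum_sum_type (α₁ := A.graph.E) (α₂ := E) _).trans (congrArg (· + _) ?_))
  rw [deg_eq_sum]
  exact Finset.sum_congr rfl fun e _ => ends_map Sum.inl_injective _ _ _

theorem deg_extend_inr (v : V) :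
    (extend A s t τV τE hs ht).graph.deg (.inr v) = ∑ e, ends (s e) (t e) (.inr v) := by
  refine (deg_eq_sum _ _).trans
    ((Fintype.sum_sum_type (α₁ := A.graph.E) (α₂ := E) _).trans (add_eq_right.2 ?_))
  refine Finset.sum_eq_zero fun e _ => ends_eq_zero.2 ⟨?_, ?_⟩
  · exact Sum.inl_ne_inr
  · exact Sum.inl_ne_inr

end Extend

/-! ### The result of applying a rule -/

section Apply

variable {p : ProdRule TG} {G : TypedGraph TG} (m : p.L ⟶ G)

/-- The node of `G` for a node of the context graph. -/
def contextNode : p.K.graph.V ⊕ {v // v ∉ Set.range m.onV} → G.graph.V :=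
  Sum.elim (fun k => m.onV (p.l.onV k)) Subtype.val

theorem contextNode_injective (hV : Function.Injective m.onV) :
    Function.Injective (contextNode m) := by
  rintro (k | v) (k' | v') h
  · exact congrArg _ (p.l_injV (hV h))
  · exact absurd ⟨_, h⟩ v'.2
  · exact absurd ⟨_, h.symm⟩ v.2
  · exact congrArg _ (Subtype.ext h)

theorem type_contextNode (x : p.K.graph.V ⊕ {v // v ∉ Set.range m.onV}) :
    Sum.elim p.K.type.onV (fun v : {v // v ∉ Set.range m.onV} => G.type.onV v) x =
      G.type.onV (contextNode m x) := by
  rcases x with k | v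
  · simp only [Sum.elim_inl, contextNode]
    rw [m.typeV_comm, p.l.typeV_comm]
  · rfl

variable {m}

/-- The only nodes missing from the context are the deleted ones, and by the dangling condition an
edge attached to one of them belongs to the match. -/
theorem NoDangling.exists_contextNode (hd : NoDangling p m) (e : G.graph.E)
    (he : e ∉ Set.range m.onE) {v : G.graph.V} (hv : G.graph.src e = v ∨ G.graph.tgt e = v) :
    ∃ x, contextNode m x = v := by
  by_cases h : v ∈ Set.range m.onV
  · obtain ⟨v', rfl⟩ := h
    by_contra hcon
    refine he (hd v' ?_ e hv)
    rintro ⟨k, rfl⟩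
    exact hcon ⟨.inl k, rfl⟩
  · exact ⟨.inr ⟨v, h⟩, rfl⟩

theorem NoDangling.exists_src (hd : NoDangling p m) (e : {e // e ∉ Set.range m.onE}) :
    ∃ x, contextNode m x = G.graph.src e :=
  hd.exists_contextNode e.1 e.2 (.inl rfl)

theorem NoDangling.exists_tgt (hd : NoDangling p m) (e : {e // e ∉ Set.range m.onE}) :
    ∃ x, contextNode m x = G.graph.tgt e :=
  hd.exists_contextNode e.1 e.2 (.inr rfl)

open Classical in
/-- The context graph: `K` together with the part of `G` outside the match. -/
noncomputable def context (hd : NoDangling p m) : TypedGraph TG :=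
  extend p.K (V := {v // v ∉ Set.range m.onV}) (E := {e // e ∉ Set.range m.onE})
    (fun e => (hd.exists_src e).choose) (fun e => (hd.exists_tgt e).choose)
    (fun v => G.type.onV v) (fun e => G.type.onE e)
    (fun e => by rw [type_contextNode, (hd.exists_src e).choose_spec]; exact G.type.src_comm e)
    (fun e => by rw [type_contextNode, (hd.exists_tgt e).choose_spec]; exact G.type.tgt_comm e)

theorem contextNode_src (hd : NoDangling p m) (e : {e // e ∉ Set.range m.onE}) :
    contextNode m ((context hd).graph.src (.inr e)) = G.graph.src e :=
  (hd.exists_src e).choose_spec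

theorem contextNode_tgt (hd : NoDangling p m) (e : {e // e ∉ Set.range m.onE}) :
    contextNode m ((context hd).graph.tgt (.inr e)) = G.graph.tgt e :=
  (hd.exists_tgt e).choose_spec

open Classical in
/-- The node of the result graph for a node of `R`. -/
noncomputable def resultNode (m : p.L ⟶ G) (v : p.R.graph.V) :
    (p.K.graph.V ⊕ {v // v ∉ Set.range m.onV}) ⊕ {v // v ∉ Set.range p.r.onV} :=
  if h : ∃ k, p.r.onV k = v then .inl (.inl h.choose) else .inr ⟨v, h⟩

theorem resultNode_inclusion (m : p.L ⟶ G) (k : p.K.graph.V) :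
    resultNode m (p.r.onV k) = .inl (.inl k) := by
  have h : ∃ k', p.r.onV k' = p.r.onV k := ⟨k, rfl⟩
  rw [resultNode, dif_pos h, p.r_injV h.choose_spec]

theorem resultNode_new (m : p.L ⟶ G) (v : {v // v ∉ Set.range p.r.onV}) :
    resultNode m v = .inr v := by
  exact dif_neg v.2

theorem resultNode_injective (m : p.L ⟶ G) : Function.Injective (resultNode m) := by
  intro v v' h
  by_cases h1 : v ∈ Set.range p.r.onV <;> by_cases h2 : v' ∈ Set.range p.r.onV
  · obtain ⟨k, rfl⟩ := h1
    obtain ⟨k', rfl⟩ := h2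
    rw [resultNode_inclusion, resultNode_inclusion] at h
    rw [Sum.inl_injective (Sum.inl_injective h)]
  · obtain ⟨k, rfl⟩ := h1
    rw [resultNode_inclusion, resultNode_new m ⟨v', h2⟩] at h
    cases h
  · obtain ⟨k, rfl⟩ := h2
    rw [resultNode_inclusion, resultNode_new m ⟨v, h1⟩] at h
    cases h
  · rw [resultNode_new m ⟨v, h1⟩, resultNode_new m ⟨v', h2⟩] at h
    exact congrArg Subtype.val (Sum.inr_injective h)

theorem type_resultNode (hd : NoDangling p m) (v : p.R.graph.V) :
    Sum.elim (context hd).type.onV (fun v : {v // v ∉ Set.range p.r.onV} => p.R.type.onV v)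
      (resultNode m v) = p.R.type.onV v := by
  by_cases h : v ∈ Set.range p.r.onV
  · obtain ⟨k, rfl⟩ := h
    rw [resultNode_inclusion, p.r.typeV_comm]
    rfl
  · rw [resultNode_new m ⟨v, h⟩]
    rfl

open Classical in
/-- The graph that results from applying the rule `p` at `m`. -/
noncomputable def result (hd : NoDangling p m) : TypedGraph TG :=
  extend (context hd) (V := {v // v ∉ Set.range p.r.onV}) (E := {e // e ∉ Set.range p.r.onE})
    (fun e => resultNode m (p.R.graph.src e)) (fun e => resultNode m (p.R.graph.tgt e))
    (fun v => p.R.type.onV v) (fun e => p.R.type.onE e)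
    (fun e => by rw [type_resultNode]; exact p.R.type.src_comm e)
    (fun e => by rw [type_resultNode]; exact p.R.type.tgt_comm e)

/-- The context graph as a part of `G`. -/
def contextHom (hd : NoDangling p m) : context hd ⟶ G where
  onV := contextNode m
  onE := Sum.elim (fun k => m.onE (p.l.onE k)) Subtype.val
  src_comm := by
    rintro (e | e)
    · exact (congrArg m.onV (p.l.src_comm e)).trans (m.src_comm _)
    · exact contextNode_src hd e
  tgt_comm := by
    rintro (e | e)
    · exact (congrArg m.onV (p.l.tgt_comm e)).trans (m.tgt_comm _)
    · exact contextNode_tgt hd e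
  typeV_comm := fun v => (type_contextNode m v).symm
  typeE_comm := by
    rintro (e | e)
    · exact (m.typeE_comm _).trans (p.l.typeE_comm e)
    · rfl

open Classical in
/-- The edge of the result graph for an edge of `R`. -/
noncomputable def resultEdge (m : p.L ⟶ G) (e : p.R.graph.E) :
    (p.K.graph.E ⊕ {e // e ∉ Set.range m.onE}) ⊕ {e // e ∉ Set.range p.r.onE} :=
  if h : ∃ k, p.r.onE k = e then .inl (.inl h.choose) else .inr ⟨e, h⟩

theorem resultEdge_inclusion (m : p.L ⟶ G) (k : p.K.graph.E) :
    resultEdge m (p.r.onE k) = .inl (.inl k) := by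
  have h : ∃ k', p.r.onE k' = p.r.onE k := ⟨k, rfl⟩
  rw [resultEdge, dif_pos h, p.r_injE h.choose_spec]

theorem resultEdge_new (m : p.L ⟶ G) (e : {e // e ∉ Set.range p.r.onE}) :
    resultEdge m e = .inr e :=
  dif_neg e.2

theorem resultEdge_injective (m : p.L ⟶ G) : Function.Injective (resultEdge m) := by
  intro e e' h
  by_cases h1 : e ∈ Set.range p.r.onE <;> by_cases h2 : e' ∈ Set.range p.r.onE
  · obtain ⟨k, rfl⟩ := h1
    obtain ⟨k', rfl⟩ := h2
    rw [resultEdge_inclusion, resultEdge_inclusion] at h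
    rw [Sum.inl_injective (Sum.inl_injective h)]
  · obtain ⟨k, rfl⟩ := h1
    rw [resultEdge_inclusion, resultEdge_new m ⟨e', h2⟩] at h
    cases h
  · obtain ⟨k, rfl⟩ := h2
    rw [resultEdge_inclusion, resultEdge_new m ⟨e, h1⟩] at h
    cases h
  · rw [resultEdge_new m ⟨e, h1⟩, resultEdge_new m ⟨e', h2⟩] at h
    exact congrArg Subtype.val (Sum.inr_injective h)

/-- The comatch of the right-hand side into the result graph. -/
noncomputable def resultHom (hd : NoDangling p m) : p.R ⟶ result hd where
  onV := resultNode m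
  onE := resultEdge m
  src_comm e := by
    by_cases h : e ∈ Set.range p.r.onE
    · obtain ⟨k, rfl⟩ := h
      exact ((congrArg (resultNode m) (p.r.src_comm k).symm).trans
        (resultNode_inclusion m _)).trans
          (congrArg (result hd).graph.src (resultEdge_inclusion m k)).symm
    · exact (congrArg (result hd).graph.src (resultEdge_new m ⟨e, h⟩)).symm
  tgt_comm e := by
    by_cases h : e ∈ Set.range p.r.onE
    · obtain ⟨k, rfl⟩ := h
      exact ((congrArg (resultNode m) (p.r.tgt_comm k).symm).trans
        (resultNode_inclusion m _)).trans
          (congrArg (result hd).graph.tgt (resultEdge_inclusion m k)).symm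
    · exact (congrArg (result hd).graph.tgt (resultEdge_new m ⟨e, h⟩)).symm
  typeV_comm v := type_resultNode hd v
  typeE_comm e := by
    by_cases h : e ∈ Set.range p.r.onE
    · obtain ⟨k, rfl⟩ := h
      exact (congrArg (result hd).type.onE (resultEdge_inclusion m k)).trans (p.r.typeE_comm k).symm
    · exact congrArg (result hd).type.onE (resultEdge_new m ⟨e, h⟩)

theorem directDerivation_result (hV : Function.Injective m.onV) (hE : Function.Injective m.onE)
    (hd : NoDangling p m) : DirectDerivation p G (result hd) m := by
  classical
  refine ⟨hV, hE, context hd, extendInl _ _ _ _ _ _ _, contextHom hd, extendInl _ _ _ _ _ _ _,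
    resultHom hd, ?_, ?_⟩
  · refine isPushout_of_injective (hom_ext (fun _ => rfl) (fun _ => rfl)) hV hE
      (contextNode_injective m hV) ?_ ?_ ?_ ?_ ?_
    · rintro (k | v) (k' | v') h
      · exact congrArg _ (p.l_injE (hE h))
      · exact absurd ⟨_, h⟩ v'.2
      · exact absurd ⟨_, h.symm⟩ v.2
      · exact congrArg _ (Subtype.ext h)
    · rintro x (k | v) h
      · exact ⟨k, (hV h).symm⟩
      · exact absurd ⟨x, h⟩ v.2
    · rintro x (k | v) h
      · exact ⟨k, (hE h).symm⟩
      · exact absurd ⟨x, h⟩ v.2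
    · intro y
      by_cases h : y ∈ Set.range m.onV
      · exact .inl h
      · exact .inr ⟨.inr ⟨y, h⟩, rfl⟩
    · intro y
      by_cases h : y ∈ Set.range m.onE
      · exact .inl h
      · exact .inr ⟨.inr ⟨y, h⟩, rfl⟩
  · refine isPushout_of_injective
      (hom_ext (resultNode_inclusion m) (resultEdge_inclusion m))
      (resultNode_injective m) (resultEdge_injective m) Sum.inl_injective Sum.inl_injective ?_ ?_ ?_ ?_
    · intro x d h
      by_contra hx
      have := (resultNode_new m ⟨x, hx⟩).symm.trans h
      cases this
    · intro x d h
      by_contra hx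
      have := (resultEdge_new m ⟨x, hx⟩).symm.trans h
      cases this
    · rintro (y | y)
      · exact .inr ⟨y, rfl⟩
      · exact .inl ⟨y, resultNode_new m y⟩
    · rintro (y | y)
      · exact .inr ⟨y, rfl⟩
      · exact .inl ⟨y, resultEdge_new m y⟩

theorem ends_context (hV : Function.Injective m.onV) (hd : NoDangling p m)
    (e : {e // e ∉ Set.range m.onE}) (x : p.K.graph.V ⊕ {v // v ∉ Set.range m.onV}) :
    ends (hd.exists_src e).choose (hd.exists_tgt e).choose x =
      ends (G.graph.src e) (G.graph.tgt e) (contextNode m x) := by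
  rw [← ends_map (contextNode_injective m hV), (hd.exists_src e).choose_spec,
    (hd.exists_tgt e).choose_spec]

open Classical in
theorem deg_result_inl (hd : NoDangling p m)
    (x : p.K.graph.V ⊕ {v // v ∉ Set.range m.onV}) :
    (result hd).graph.deg (.inl x) = (context hd).graph.deg x +
      ∑ e : {e // e ∉ Set.range p.r.onE},
        ends (resultNode m (p.R.graph.src e)) (resultNode m (p.R.graph.tgt e)) (.inl x) :=
  deg_extend_inl _ _ _ _ _ _ _ _

/-- The degree of a preserved node. -/
theorem deg_result_preserved (hV : Function.Injective m.onV) (hE : Function.Injective m.onE)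
    (hd : NoDangling p m) (k : p.K.graph.V) :
    (result hd).graph.deg (.inl (.inl k)) + p.L.graph.deg (p.l.onV k) =
      G.graph.deg (m.onV (p.l.onV k)) + p.R.graph.deg (p.r.onV k) := by
  classical
  have h1 := deg_result_inl hd (.inl k)
  have h2 : (context hd).graph.deg (.inl k) = p.K.graph.deg k +
      ∑ e : {e // e ∉ Set.range m.onE},
        ends (G.graph.src e) (G.graph.tgt e) (m.onV (p.l.onV k)) :=
    (deg_extend_inl _ _ _ _ _ _ _ _).trans
      (congrArg (_ + ·) (Finset.sum_congr rfl fun e _ => ends_context hV hd e (.inl k)))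
  have h3 := deg_hom hV hE (p.l.onV k)
  have h4 := deg_hom p.r_injV p.r_injE k
  have h5 : ∑ e : {e // e ∉ Set.range p.r.onE},
        ends (resultNode m (p.R.graph.src e)) (resultNode m (p.R.graph.tgt e)) (.inl (.inl k)) =
      ∑ e : {e // e ∉ Set.range p.r.onE},
        ends (p.R.graph.src e) (p.R.graph.tgt e) (p.r.onV k) :=
    Finset.sum_congr rfl fun e _ => by
      rw [← resultNode_inclusion m, ends_map (resultNode_injective m)]
  -- Let `a` count the ends at the node of edges of `G` outside the match, and `b` those of new
  -- edges of `R`. Then `deg_H = deg_K + a + b`, `deg_G = deg_L + a` and `deg_R = deg_K + b`. The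
  -- additive form avoids truncated subtraction.
  rw [h5, h2] at h1
  omega

/-- The degree of a node outside the match. -/
theorem deg_result_outside (hV : Function.Injective m.onV) (hE : Function.Injective m.onE)
    (hd : NoDangling p m) (v : {v // v ∉ Set.range m.onV}) :
    (result hd).graph.deg (.inl (.inr v)) = G.graph.deg v := by
  classical
  have h1 := deg_result_inl hd (.inr v)
  have h2 : (context hd).graph.deg (.inr v) = ∑ e : {e // e ∉ Set.range m.onE},
      ends (G.graph.src e) (G.graph.tgt e) v :=
    (deg_extend_inr _ _ _ _ _ _ _ _).trans
      (Finset.sum_congr rfl fun e _ => ends_context hV hd e (.inr v))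
  have h3 := deg_of_notMem_range hE v.2
  -- New edges end at nodes of `R`, so they never touch a node outside the match.
  have hne : ∀ w, resultNode m w ≠ .inl (.inr v) := by
    intro w hw
    by_cases h : w ∈ Set.range p.r.onV
    · obtain ⟨k, rfl⟩ := h
      rw [resultNode_inclusion] at hw
      cases hw
    · rw [resultNode_new m ⟨w, h⟩] at hw
      cases hw
  rw [h1, h2, h3, add_eq_left]
  exact Finset.sum_eq_zero fun e _ => ends_eq_zero.2 ⟨hne _, hne _⟩

/-- The degree of a new node. -/
theorem deg_result_new (hd : NoDangling p m) (v : {v // v ∉ Set.range p.r.onV}) :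
    (result hd).graph.deg (.inr v) = p.R.graph.deg v := by
  classical
  have h1 : (result hd).graph.deg (.inr v) = ∑ e : {e // e ∉ Set.range p.r.onE},
      ends (resultNode m (p.R.graph.src e)) (resultNode m (p.R.graph.tgt e)) (.inr v) :=
    deg_extend_inr _ _ _ _ _ _ _ _
  rw [h1, deg_of_notMem_range p.r_injE v.2]
  refine Finset.sum_congr rfl fun e _ => ?_
  rw [← resultNode_new m v, ends_map (resultNode_injective m)]

end Apply

end GTSCHR

/-! ### Evaluation of an encoded rule and soundness -/

namespace GTSCHR

open FirstOrder FirstOrder.Language CategoryTheory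

variable {L : FirstOrder.Language.{a, b}} {X : Type w} {TG : DirGraph.{u}}
  (CT : ConstraintTheory L)

theorem map_univ_range {α ι κ : Type*} [Fintype ι] [Fintype κ] {m : ι → κ}
    (hm : Function.Injective m) [Fintype {y // y ∉ Set.range m}] (f : κ → α) :
    (Finset.univ : Finset κ).val.map f = (Finset.univ : Finset ι).val.map (fun i => f (m i)) +
      (Finset.univ : Finset {y // y ∉ Set.range m}).val.map
        (fun y : {y // y ∉ Set.range m} => f y.1) := by
  classical
  let e : ι ⊕ {y // y ∉ Set.range m} ≃ κ :=
    (Equiv.sumCongr (Equiv.ofInjective m hm) (Equiv.refl _)).trans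
      (Equiv.sumCompl fun y => y ∈ Set.range m)
  rw [map_univ_equiv e, map_univ_sum]
  rfl

section Rule

variable (p : ProdRule TG) (η : RuleVar p ↪ X)

/-! ### The variables of an encoded rule -/

/-- The variables that occur only in the body of the encoded rule. -/
def RuleVar.IsBodyVar {p : ProdRule TG} : RuleVar p → Prop
  | .primeNode _ => True
  | .primeDegree _ => True
  | .newNode v => v ∉ Set.range p.r.onV
  | .newEdge e => e ∉ Set.range p.r.onE
  | _ => False

open Classical in
/-- The second argument of the head constraint for a node. -/
noncomputable def headDegree (v : p.L.graph.V) : L.Term X :=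
  if v ∈ Set.range p.l.onV then .var (η (.degree v)) else (CT.num (p.L.graph.deg v)).term

/-- The head constraints, indexed by the nodes and edges of `L`. -/
noncomputable def headConstraint : Item p.L → UserConstraint L (typeArity TG) X
  | .inl v => nodeConstraint (p.L.type.onV v) (.var (η (.node v))) (headDegree CT p η v)
  | .inr e => edgeConstraint (p.L.type.onE e) (.var (η (.edge e)))
      (.var (η (.node (p.L.graph.src e)))) (.var (η (.node (p.L.graph.tgt e))))

theorem headOf_eq_map :
    headOf CT p η = (Finset.univ : Finset (Item p.L)).val.map (headConstraint CT p η) :=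
  (map_univ_sum (headConstraint CT p η)).symm

theorem termVars_num (n : ℤ) : termVars (CT.num n).term = (∅ : Set X) :=
  Set.iUnion_of_empty _

theorem exists_of_mem_vars_headConstraint {i : Item p.L} {x : X}
    (hx : x ∈ (headConstraint CT p η i).vars) : ∃ z, ¬ z.IsBodyVar ∧ η z = x := by
  rcases i with v | e
  · rw [headConstraint, vars_nodeConstraint, headDegree] at hx
    rcases hx with hx | hx
    · exact ⟨.node v, id, hx.symm⟩
    · split_ifs at hx
      · exact ⟨.degree v, id, hx.symm⟩
      · rw [termVars_num] at hx; exact hx.elim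
  · rw [headConstraint, vars_edgeConstraint] at hx
    rcases hx with (hx | hx) | hx
    · exact ⟨.edge e, id, hx.symm⟩
    · exact ⟨.node _, id, hx.symm⟩
    · exact ⟨.node _, id, hx.symm⟩

theorem exists_of_mem_goalVars_headOf {x : X} (hx : x ∈ goalVars (headOf CT p η)) :
    ∃ z, ¬ z.IsBodyVar ∧ η z = x := by
  rw [headOf_eq_map] at hx
  obtain ⟨c, hc, hx⟩ := hx
  obtain ⟨i, -, rfl⟩ := Multiset.mem_map.1 hc
  exact exists_of_mem_vars_headConstraint CT p η hx

theorem nodeR_inclusion (k : p.K.graph.V) :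
    RuleVar.nodeR p (p.r.onV k) = .node (p.l.onV k) := by
  have h : ∃ k', p.r.onV k' = p.r.onV k := ⟨k, rfl⟩
  rw [RuleVar.nodeR, dif_pos h, p.r_injV h.choose_spec]

theorem nodeR_new {v : p.R.graph.V} (hv : v ∉ Set.range p.r.onV) :
    RuleVar.nodeR p v = .newNode v :=
  dif_neg hv

/-! ### Evaluation of an encoded rule -/

variable {p}

theorem storeHolds_bodyBuiltinOf (M : CT.Model) (ν : X → M) :
    StoreHolds ν (bodyBuiltinOf CT p η) ↔ ∀ k : p.K.graph.V,
      ν (η (.node (p.l.onV k))) = ν (η (.primeNode k)) ∧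
      ν (η (.primeDegree k)) = Structure.funMap CT.add
        ![Structure.funMap CT.sub
          ![ν (η (.degree (p.l.onV k))), CT.val M (p.L.graph.deg (p.l.onV k))],
          CT.val M (p.R.graph.deg (p.r.onV k))] := by
  simp only [StoreHolds, bodyBuiltinOf, List.mem_flatMap, Finset.mem_toList, Finset.mem_univ,
    true_and, forall_exists_index]
  rw [forall_comm]
  refine forall_congr' fun k => ?_
  simp [Builtin.Holds, ConstraintTheory.val]

variable {G : TypedGraph TG} {m : p.L ⟶ G}

/-- A valuation under which the head becomes the part of the ground encoding of `G` given by the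
match `m`. -/
structure HeadValues (m : p.L ⟶ G) (M : CT.Model) (ν : X → M) (x : Item G → M) : Prop where
  node : ∀ v, ν (η (.node v)) = x (.inl (m.onV v))
  edge : ∀ e, ν (η (.edge e)) = x (.inr (m.onE e))
  degree : ∀ k, ν (η (.degree (p.l.onV k))) = degVal CT M G (m.onV (p.l.onV k))

theorem eval_headConstraint_node (M : CT.Model) (ν : X → M) (v : p.L.graph.V) :
    (headConstraint CT p η (.inl v)).eval ν =
      (.inl (p.L.type.onV v), [ν (η (.node v)), (headDegree CT p η v).realize ν]) := rfl

theorem eval_headConstraint_edge (M : CT.Model) (ν : X → M) (e : p.L.graph.E) :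
    (headConstraint CT p η (.inr e)).eval ν =
      (.inr (p.L.type.onE e), [ν (η (.edge e)), ν (η (.node (p.L.graph.src e))),
        ν (η (.node (p.L.graph.tgt e)))]) := rfl

theorem realize_headDegree_inclusion (M : CT.Model) (ν : X → M) (k : p.K.graph.V) :
    (headDegree CT p η (p.l.onV k)).realize ν = ν (η (.degree (p.l.onV k))) := by
  rw [headDegree, if_pos ⟨k, rfl⟩]
  rfl

theorem realize_headDegree_of_notMem (M : CT.Model) (ν : X → M) {v : p.L.graph.V}
    (hv : v ∉ Set.range p.l.onV) :
    (headDegree CT p η v).realize ν = CT.val M (p.L.graph.deg v) := by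
  rw [headDegree, if_neg hv, CT.realize_num]

variable {CT η}

theorem HeadValues.of_eval {M : CT.Model} {ν : X → M} {x : Item G → M}
    (hV : ∀ v, (headConstraint CT p η (.inl v)).eval ν =
      pattern G x (degVal CT M G) (.inl (m.onV v)))
    (hE : ∀ e, (headConstraint CT p η (.inr e)).eval ν =
      pattern G x (degVal CT M G) (.inr (m.onE e))) : HeadValues CT η m M ν x where
  node v := by
    have := hV v
    simp only [eval_headConstraint_node, pattern, Prod.mk.injEq, List.cons.injEq] at this
    exact this.2.1
  edge e := by
    have := hE e
    simp only [eval_headConstraint_edge, pattern, Prod.mk.injEq, List.cons.injEq] at this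
    exact this.2.1
  degree k := by
    have := hV (p.l.onV k)
    simp only [eval_headConstraint_node, pattern, Prod.mk.injEq, List.cons.injEq,
      realize_headDegree_inclusion] at this
    exact this.2.2.1

/-- The arithmetic of the body computes the degrees of the preserved nodes in the result. -/
theorem degree_update {M : CT.Model} (hV : Function.Injective m.onV)
    (hE : Function.Injective m.onE) (hd : NoDangling p m) (k : p.K.graph.V) :
    Structure.funMap CT.add ![Structure.funMap CT.sub
      ![degVal CT M G (m.onV (p.l.onV k)), CT.val M (p.L.graph.deg (p.l.onV k))],
        CT.val M (p.R.graph.deg (p.r.onV k))] = degVal CT M (result hd) (.inl (.inl k)) := by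
  rw [degVal, CT.funMap_sub, CT.funMap_add]
  have h := deg_result_preserved hV hE hd k
  exact congrArg (CT.val M) (by omega : _ = (((result hd).graph.deg (.inl (.inl k)) : ℕ) : ℤ))

/-! ### The constraints of the result -/

/-- The constraints after a rule application, indexed by the nodes and edges of the result. -/
noncomputable def resultConstraint (CT : ConstraintTheory L) (η : RuleVar p ↪ X)
    (hd : NoDangling p m) (c : Item G → UserConstraint L (typeArity TG) X) :
    Item (result hd) → UserConstraint L (typeArity TG) X :=
  Sum.elim
    (Sum.elim
      (Sum.elim
        (fun k => nodeConstraint (p.K.type.onV k) (.var (η (.primeNode k)))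
          (.var (η (.primeDegree k))))
        (fun v => c (.inl v.1)))
      (fun v => nodeConstraint (p.R.type.onV v.1) (.var (η (.newNode v.1)))
        (CT.num (p.R.graph.deg v.1)).term))
    (Sum.elim
      (Sum.elim
        (fun e => edgeConstraint (p.K.type.onE e) (.var (η (.edge (p.l.onE e))))
          (.var (η (.node (p.l.onV (p.K.graph.src e)))))
          (.var (η (.node (p.l.onV (p.K.graph.tgt e))))))
        (fun e => c (.inr e.1)))
      (fun e => edgeConstraint (p.R.type.onE e.1) (.var (η (.newEdge e.1)))
        (.var (η (RuleVar.nodeR p (p.R.graph.src e.1))))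
        (.var (η (RuleVar.nodeR p (p.R.graph.tgt e.1))))))

/-- The identifiers of the nodes and edges of the result. -/
noncomputable def resultValue (hd : NoDangling p m) {M : Type*} (ν : RuleVar p → M)
    (x : Item G → M) : Item (result hd) → M :=
  Sum.elim
    (Sum.elim (fun d => x (.inl (contextNode m d))) (fun v => ν (.newNode v.1)))
    (Sum.elim (Sum.elim (fun e => x (.inr (m.onE (p.l.onE e)))) (fun e => x (.inr e.1)))
      (fun e => ν (.newEdge e.1)))

theorem eval_nodeR (hd : NoDangling p m) {M : CT.Model} {ν : X → M} {x : Item G → M}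
    (h : HeadValues CT η m M ν x) (v : p.R.graph.V) :
    ν (η (RuleVar.nodeR p v)) =
      resultValue hd (fun z => ν (η z)) x (.inl (resultNode m v)) := by
  by_cases hv : v ∈ Set.range p.r.onV
  · obtain ⟨k, rfl⟩ := hv
    rw [nodeR_inclusion, h.node, resultNode_inclusion]
    rfl
  · rw [nodeR_new p hv, resultNode_new m ⟨v, hv⟩]
    rfl

/-- Preserved nodes receive their new degree from the arithmetic of the body, unmatched nodes keep
constraint and degree, and new nodes have the same degree in the result as in `R`. Endpoints of new
edges are named through `eval_nodeR`. -/
theorem eval_resultConstraint (hV : Function.Injective m.onV) (hE : Function.Injective m.onE)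
    (hd : NoDangling p m) {c : Item G → UserConstraint L (typeArity TG) X} {M : CT.Model}
    {ν : X → M} {x : Item G → M} (hc : ∀ i, (c i).eval ν = pattern G x (degVal CT M G) i)
    (h : HeadValues CT η m M ν x) (hB : StoreHolds ν (bodyBuiltinOf CT p η))
    (i : Item (result hd)) :
    (resultConstraint CT η hd c i).eval ν =
      pattern (result hd) (resultValue hd (fun z => ν (η z)) x) (degVal CT M (result hd)) i := by
  rw [storeHolds_bodyBuiltinOf] at hB
  rcases i with ((k | v) | v) | ((e | e) | e)
  · have h1 : ν (η (.primeNode k)) = x (.inl (m.onV (p.l.onV k))) := by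
      rw [← (hB k).1, h.node]
    have h2 : ν (η (.primeDegree k)) = degVal CT M (result hd) (.inl (.inl k)) := by
      rw [(hB k).2, h.degree, degree_update hV hE hd]
    refine (eval_nodeConstraint ν _ _ _).trans ?_
    rw [Term.realize_var, Term.realize_var, h1, h2]
    rfl
  · refine (hc (.inl v.1)).trans ?_
    have h2 : degVal CT M G v.1 = degVal CT M (result hd) (.inl (.inr v)) :=
      congrArg (fun n : ℕ => CT.val M n) (deg_result_outside hV hE hd v).symm
    rw [pattern, h2]
    rfl
  · refine (eval_nodeConstraint ν _ _ _).trans ?_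
    have h2 : CT.val M (p.R.graph.deg v.1) = degVal CT M (result hd) (.inr v) :=
      congrArg (fun n : ℕ => CT.val M n) (deg_result_new hd v).symm
    rw [CT.realize_num, h2]
    rfl
  · refine (eval_edgeConstraint ν _ _ _ _).trans ?_
    rw [Term.realize_var, Term.realize_var, Term.realize_var, h.edge, h.node, h.node]
    rfl
  · refine (hc (.inr e.1)).trans ?_
    rw [pattern, ← contextNode_src hd e, ← contextNode_tgt hd e]
    rfl
  · refine (eval_edgeConstraint ν _ _ _ _).trans ?_
    rw [Term.realize_var, Term.realize_var, Term.realize_var, eval_nodeR hd h, eval_nodeR hd h]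
    rfl

/-- Cancelling the head identifies `A` with the constraints of the unmatched nodes and edges.
Together with the body these are the six families of items of the result, up to order. -/
theorem bodyUserOf_add (hd : NoDangling p m) {A : Multiset (UserConstraint L (typeArity TG) X)}
    (hV : Function.Injective m.onV) (hE : Function.Injective m.onE)
    {c : Item G → UserConstraint L (typeArity TG) X}
    (hA : headOf CT p η + A = (Finset.univ : Finset (Item G)).val.map c)
    (hcV : ∀ v, c (.inl (m.onV v)) = headConstraint CT p η (.inl v))
    (hcE : ∀ e, c (.inr (m.onE e)) = headConstraint CT p η (.inr e)) :
    bodyUserOf CT p η + A =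
      (Finset.univ : Finset (Item (result hd))).val.map (resultConstraint CT η hd c) := by
  classical
  rw [headOf_eq_map, map_univ_sum, map_univ_sum, map_univ_range hV, map_univ_range hE] at hA
  simp only [hcV, hcE] at hA
  have hA' : A =
      (Finset.univ : Finset {v // v ∉ Set.range m.onV}).val.map
        (fun v : {v // v ∉ Set.range m.onV} => c (.inl v.1)) +
      (Finset.univ : Finset {e // e ∉ Set.range m.onE}).val.map
        (fun e : {e // e ∉ Set.range m.onE} => c (.inr e.1)) := by
    rw [add_add_add_comm] at hA
    exact add_left_cancel hA
  have hres : (Finset.univ : Finset (Item (result hd))).val.map (resultConstraint CT η hd c) =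
      (((Finset.univ : Finset p.K.graph.V).val.map (fun v =>
          nodeConstraint (p.K.type.onV v) (.var (η (.primeNode v))) (.var (η (.primeDegree v)))) +
        (Finset.univ : Finset {v // v ∉ Set.range m.onV}).val.map
          (fun v : {v // v ∉ Set.range m.onV} => c (.inl v.1))) +
        (Finset.univ : Finset {v // v ∉ Set.range p.r.onV}).val.map
          (fun v : {v // v ∉ Set.range p.r.onV} =>
            nodeConstraint (p.R.type.onV v.1) (.var (η (.newNode v.1)))
              (CT.num (p.R.graph.deg v.1)).term)) +
      (((Finset.univ : Finset p.K.graph.E).val.map (fun e =>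
          edgeConstraint (p.K.type.onE e) (.var (η (.edge (p.l.onE e))))
            (.var (η (.node (p.l.onV (p.K.graph.src e)))))
            (.var (η (.node (p.l.onV (p.K.graph.tgt e)))))) +
        (Finset.univ : Finset {e // e ∉ Set.range m.onE}).val.map
          (fun e : {e // e ∉ Set.range m.onE} => c (.inr e.1))) +
        (Finset.univ : Finset {e // e ∉ Set.range p.r.onE}).val.map
          (fun e : {e // e ∉ Set.range p.r.onE} =>
            edgeConstraint (p.R.type.onE e.1) (.var (η (.newEdge e.1)))
              (.var (η (RuleVar.nodeR p (p.R.graph.src e.1))))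
              (.var (η (RuleVar.nodeR p (p.R.graph.tgt e.1)))))) := by
    refine (map_univ_sum _).trans (congrArg₂ (· + ·) ?_ ?_)
    · exact (map_univ_sum _).trans (congrArg₂ (· + ·) (map_univ_sum _) rfl)
    · exact (map_univ_sum _).trans (congrArg₂ (· + ·) (map_univ_sum _) rfl)
  rw [hres, hA', bodyUserOf, map_filter_univ, map_filter_univ]
  abel

/-- A valuation of the variables of the body that yields given identifiers of the result. -/
theorem exists_body_valuation (hV : Function.Injective m.onV) (hE : Function.Injective m.onE)
    (hd : NoDangling p m) {M : CT.Model} {ν : X → M} {x : Item G → M}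
    (h : HeadValues CT η m M ν x) (x' : Item (result hd) → M)
    (hx : ∀ d, x (.inl (contextNode m d)) = x' (.inl (.inl d))) :
    ∃ ν' : X → M, (∀ y, (∀ z : RuleVar p, z.IsBodyVar → η z ≠ y) → ν' y = ν y) ∧
      StoreHolds ν' (bodyBuiltinOf CT p η) ∧
      (∀ v : {v // v ∉ Set.range p.r.onV}, ν' (η (.newNode v.1)) = x' (.inl (.inr v))) ∧
      ∀ e : {e // e ∉ Set.range p.r.onE}, ν' (η (.newEdge e.1)) = x' (.inr (.inr e)) := by
  classical
  -- Only the values at body variables are used below. Going through `resultNode` and `resultEdge`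
  -- makes these clauses total, without a proof that the item is new.
  let val : RuleVar p → M := fun z => match z with
    | .primeNode k => x' (.inl (.inl (.inl k)))
    | .primeDegree k => degVal CT M (result hd) (.inl (.inl k))
    | .newNode v => x' (.inl (resultNode m v))
    | .newEdge e => x' (.inr (resultEdge m e))
    | z => ν (η z)
  let ν' : X → M := fun y =>
    if hy : ∃ z : RuleVar p, z.IsBodyVar ∧ η z = y then val hy.choose else ν y
  have h1 : ∀ z : RuleVar p, z.IsBodyVar → ν' (η z) = val z := by
    intro z hz
    have hy : ∃ z' : RuleVar p, z'.IsBodyVar ∧ η z' = η z := ⟨z, hz, rfl⟩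
    have : ν' (η z) = val hy.choose := dif_pos hy
    rw [this, η.injective hy.choose_spec.2]
  have h2 : ∀ y, (∀ z : RuleVar p, z.IsBodyVar → η z ≠ y) → ν' y = ν y := by
    intro y hy
    exact dif_neg (by rintro ⟨z, hz, hzy⟩; exact hy z hz hzy)
  have h3 : ∀ z : RuleVar p, ¬ z.IsBodyVar → ν' (η z) = ν (η z) := by
    intro z hz
    refine h2 _ fun z' hz' he => hz (η.injective he ▸ hz')
  refine ⟨ν', h2, (storeHolds_bodyBuiltinOf CT η M ν').2 fun k => ⟨?_, ?_⟩, ?_, ?_⟩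
  · rw [h3 _ (id : ¬ (RuleVar.node (p.l.onV k)).IsBodyVar), h1 (.primeNode k) trivial, h.node]
    exact hx (.inl k)
  · rw [h1 (.primeDegree k) trivial, h3 _ (id : ¬ (RuleVar.degree (p.l.onV k)).IsBodyVar),
      h.degree, degree_update hV hE hd]
  · intro v
    rw [h1 (.newNode v.1) v.2]
    exact congrArg (fun y => x' (.inl y)) (resultNode_new m v)
  · intro e
    rw [h1 (.newEdge e.1) e.2]
    exact congrArg (fun y => x' (.inr y)) (resultEdge_new m e)

/-- Identifiers of the nodes and edges of `G` that extend given ones of the context. -/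
theorem exists_context_values (hV : Function.Injective m.onV) (hE : Function.Injective m.onE)
    (hd : NoDangling p m) {M : Type*} [Nonempty M] (x' : Item (result hd) → M) :
    ∃ x : Item G → M, (∀ d, x (.inl (contextNode m d)) = x' (.inl (.inl d))) ∧
      ∀ d, x (.inr ((contextHom hd).onE d)) = x' (.inr (.inl d)) := by
  obtain ⟨m₀⟩ : Nonempty M := inferInstance
  have hfE : Function.Injective (contextHom hd).onE := by
    rintro (k | v) (k' | v') h
    · exact congrArg _ (p.l_injE (hE h))
    · exact absurd ⟨_, h⟩ v'.2
    · exact absurd ⟨_, h.symm⟩ v.2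
    · exact congrArg _ (Subtype.ext h)
  -- The deleted nodes and edges lie outside the context and get the arbitrary value `m₀`.
  refine ⟨Sum.elim
    (Function.extend (contextNode m) (fun d => x' (.inl (.inl d))) fun _ => m₀)
    (Function.extend (contextHom hd).onE (fun d => x' (.inr (.inl d))) fun _ => m₀), ?_, ?_⟩
  · intro d
    exact (contextNode_injective m hV).extend_apply (fun d => x' (.inl (.inl d))) (fun _ => m₀) d
  · intro d
    exact hfE.extend_apply (fun d => x' (.inr (.inl d))) (fun _ => m₀) d

/-- Soundness: when an encoded rule matches a state that represents a graph `G`, the production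
rule applies to `G`, and the new state represents the result. -/
theorem Represents.exists_derivation {A : Multiset (UserConstraint L (typeArity TG) X)}
    {B : List (Builtin L X)} {V : Finset X}
    (hfresh : ∀ z : RuleVar p, z.IsBodyVar → η z ∉ V ∧ η z ∉ goalVars A ∧ η z ∉ storeVars B)
    (h : Represents CT ⟨headOf CT p η + A, B, V⟩ G) :
    ∃ (m : p.L ⟶ G) (H : TypedGraph TG), DirectDerivation p G H m ∧
      Represents CT ⟨bodyUserOf CT p η + A, bodyBuiltinOf CT p η ++ B, V⟩ H := by
  obtain ⟨c, hA, hc⟩ := h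
  simp only at hA hc
  obtain ⟨n, g, rfl⟩ := exists_map_univ_fin A
  have hsum : (Finset.univ : Finset (Item p.L ⊕ Fin n)).val.map
      (Sum.elim (headConstraint CT p η) g) = (Finset.univ : Finset (Item G)).val.map c := by
    rw [← hA, map_univ_sum, headOf_eq_map]
    rfl
  obtain ⟨e, he⟩ := exists_equiv_of_map_univ_eq hsum
  have hμ : ∀ i, c (e (.inl i)) = headConstraint CT p η i := fun i => he (.inl i)
  obtain ⟨m, hmV, hmE, hdeg⟩ : ∃ m : p.L ⟶ G, (∀ v, e (.inl (.inl v)) = .inl (m.onV v)) ∧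
      (∀ d, e (.inl (.inr d)) = .inr (m.onE d)) ∧
      ∀ v ∉ Set.range p.l.onV, G.graph.deg (m.onV v) = p.L.graph.deg v := by
    obtain ⟨M⟩ := CT.nonempty_model
    obtain ⟨m₀⟩ : Nonempty M := inferInstance
    -- One instance with distinct identifiers suffices to see that the matched constraints form a
    -- subgraph of `G`. For a deleted node it equates two numerals, hence the two degrees.
    obtain ⟨x, hx⟩ := CT.exists_injective M (Item G)
    have : pattern G x (degVal CT M G) ∈ instances (↑V) B c (fun _ => m₀) := (hc M _) ▸ ⟨x, rfl⟩
    obtain ⟨ν, -, -, hν⟩ := this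
    obtain ⟨m, hmV, hmE⟩ := exists_hom_of_pattern hx (fun i => e (.inl i))
      (x := Sum.elim (fun v => ν (η (.node v))) fun d => ν (η (.edge d)))
      (d := fun v => (headDegree CT p η v).realize ν) (d' := degVal CT M G) fun i => by
        rw [hν]
        simp only [hμ]
        rcases i with v | d <;> rfl
    refine ⟨m, hmV, hmE, fun v hv => ?_⟩
    have h1 := congrFun hν (.inl (m.onV v))
    rw [← hmV, hμ, eval_headConstraint_node, realize_headDegree_of_notMem CT η M ν hv, hmV] at h1
    simp only [pattern, Prod.mk.injEq, List.cons.injEq] at h1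
    exact_mod_cast CT.val_injective M h1.2.2.1
  -- Distinct head constraints consume distinct members of the goal multiset.
  have hV : Function.Injective m.onV := by
    intro v v' h
    have := (hmV v).trans ((congrArg Sum.inl h).trans (hmV v').symm)
    exact Sum.inl_injective (Sum.inl_injective (e.injective this))
  have hE : Function.Injective m.onE := by
    intro v v' h
    have := (hmE v).trans ((congrArg Sum.inr h).trans (hmE v').symm)
    exact Sum.inr_injective (Sum.inl_injective (e.injective this))
  have hd : NoDangling p m := (noDangling_iff_deg hV hE).2 hdeg
  have hcV : ∀ v, c (.inl (m.onV v)) = headConstraint CT p η (.inl v) := fun v => by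
    rw [← hmV, hμ]
  have hcE : ∀ d, c (.inr (m.onE d)) = headConstraint CT p η (.inr d) := fun d => by
    rw [← hmE, hμ]
  have hhead : ∀ {M : CT.Model} {ν : X → M} {x : Item G → M},
      (∀ i, (c i).eval ν = pattern G x (degVal CT M G) i) → HeadValues CT η m M ν x :=
    fun h => .of_eval (fun v => by rw [← hcV, h]) (fun d => by rw [← hcE, h])
  refine ⟨m, result hd, directDerivation_result hV hE hd, resultConstraint CT η hd c,
    bodyUserOf_add hd hV hE hA hcV hcE, fun M ν₀ => Set.Subset.antisymm ?_ ?_⟩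
  · rintro _ ⟨ν, hν₀, hB, rfl⟩
    rw [storeHolds_append] at hB
    have : (fun i => (c i).eval ν) ∈ instances (↑V) B c ν₀ := ⟨ν, hν₀, hB.2, rfl⟩
    rw [hc] at this
    obtain ⟨x, hx⟩ := this
    have hx' : ∀ i, (c i).eval ν = pattern G x (degVal CT M G) i := fun i => (congrFun hx i).symm
    exact ⟨_, funext fun i => (eval_resultConstraint hV hE hd hx' (hhead hx') hB.1 i).symm⟩
  · rintro _ ⟨x', rfl⟩
    -- To realise prescribed identifiers of the result, realise their restriction to the context in
    -- the old state, then change the body variables only. These are fresh, so the old goal, `B` and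
    -- `V` do not notice.
    obtain ⟨x, hxV, hxE⟩ := exists_context_values hV hE hd x'
    have : pattern G x (degVal CT M G) ∈ instances (↑V) B c ν₀ := (hc M _) ▸ ⟨x, rfl⟩
    obtain ⟨ν, hν₀, hB, hν⟩ := this
    have hν1 : ∀ i, (c i).eval ν = pattern G x (degVal CT M G) i := fun i => (congrFun hν i).symm
    obtain ⟨ν', hν', hbody, hnode, hedge⟩ := exists_body_valuation hV hE hd (hhead hν1) x' hxV
    have hν2 : ∀ i, (c i).eval ν' = pattern G x (degVal CT M G) i := by
      intro i
      rw [← hν1 i]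
      refine UserConstraint.eval_congr _ fun y hy => hν' y ?_
      rintro z hz rfl
      have hmem := mem_vars_of_mem_map c i hy
      rw [← hA] at hmem
      obtain ⟨d, hd, hzd⟩ := hmem
      rcases Multiset.mem_add.1 hd with hd | hd
      · obtain ⟨z', hz', heq⟩ := exists_of_mem_goalVars_headOf CT p η ⟨d, hd, hzd⟩
        exact hz' (η.injective heq ▸ hz)
      · exact (hfresh z hz).2.1 ⟨d, hd, hzd⟩
    have hB' : StoreHolds ν' B := by
      refine (storeHolds_congr B fun y hy => hν' y ?_).2 hB
      rintro z hz rfl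
      exact (hfresh z hz).2.2 hy
    refine ⟨ν', fun y hy => ?_, (storeHolds_append _ _).2 ⟨hbody, hB'⟩, ?_⟩
    · rw [hν' y, hν₀ y hy]
      rintro z hz rfl
      exact (hfresh z hz).1 hy
    · have hval : resultValue hd (fun z => ν' (η z)) x = x' := by
        funext i
        rcases i with (d | v) | (d | e)
        · exact hxV d
        · exact hnode v
        · rcases d with k | d
          · exact hxE (.inl k)
          · exact hxE (.inr d)
        · exact hedge e
      funext i
      refine Eq.trans ?_ (eval_resultConstraint hV hE hd hν2 (hhead hν2) hbody i).symm
      simp only [hval]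

end Rule

end GTSCHR

/-! ### Fresh rule copies, completeness and simulation -/

namespace GTSCHR

open FirstOrder FirstOrder.Language CategoryTheory

variable {L : FirstOrder.Language.{a, b}} {X : Type w} {TG : DirGraph.{u}}
  (CT : ConstraintTheory L)

/-! ### Renaming and the variables of the body -/

theorem mem_goalVars_add {C : Type u} {arity : C → ℕ} {s t : Multiset (UserConstraint L arity X)}
    {x : X} : x ∈ goalVars (s + t) ↔ x ∈ goalVars s ∨ x ∈ goalVars t := by
  simp [goalVars, or_and_right, exists_or]

theorem mem_goalVars_map {C ι : Type*} {arity : C → ℕ} {s : Multiset ι}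
    {f : ι → UserConstraint L arity X} {x : X} :
    x ∈ goalVars (s.map f) ↔ ∃ i ∈ s, x ∈ (f i).vars := by
  simp [goalVars]

section Rule

variable (p : ProdRule TG) (η : RuleVar p ↪ X)

theorem relabel_num (ρ : X → X) (n : ℤ) :
    ((CT.num n).term : L.Term X).relabel ρ = (CT.num n).term := by
  simp only [Constants.term, Term.relabel]
  congr 1
  funext i
  exact i.elim0

theorem relabel_apply₂ (ρ : X → X) (f : L.Functions 2) (s t : L.Term X) :
    (f.apply₂ s t).relabel ρ = f.apply₂ (s.relabel ρ) (t.relabel ρ) := by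
  simp only [Functions.apply₂, Term.relabel]
  congr 1
  funext i
  revert i
  exact Fin.forall_fin_two.2 ⟨rfl, rfl⟩

/-- A renamed copy is again an encoding, for other distinct variables. Hence soundness, proved for
an arbitrary choice `η`, covers every fresh copy of the rule. -/
theorem rename_encodeRule (ρ : X → X) (hρ : Function.Injective ρ) :
    (encodeRule CT p η).rename ρ = encodeRule CT p (η.trans ⟨ρ, hρ⟩) := by
  have h1 : (headOf CT p η).map (UserConstraint.rename ρ) = headOf CT p (η.trans ⟨ρ, hρ⟩) := by
    simp only [headOf, Multiset.map_add, Multiset.map_map, Function.comp_def,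
      rename_nodeConstraint, rename_edgeConstraint, apply_ite (Term.relabel ρ), relabel_num,
      Term.relabel]
    rfl
  have h2 : (bodyUserOf CT p η).map (UserConstraint.rename ρ) =
      bodyUserOf CT p (η.trans ⟨ρ, hρ⟩) := by
    simp only [bodyUserOf, Multiset.map_add, Multiset.map_map, Function.comp_def,
      rename_nodeConstraint, rename_edgeConstraint, relabel_num, Term.relabel]
    rfl
  have h3 : (bodyBuiltinOf CT p η).map (Builtin.rename ρ) =
      bodyBuiltinOf CT p (η.trans ⟨ρ, hρ⟩) := by
    simp only [bodyBuiltinOf, List.map_flatMap, List.map_cons, List.map_nil, Builtin.rename,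
      relabel_num, Term.relabel, relabel_apply₂]
    rfl
  simp only [CHRRule.rename, encodeRule, h1, h2, h3, Multiset.map_zero, List.map_nil]

theorem headVars_encodeRule : (encodeRule CT p η).headVars = goalVars (headOf CT p η) := by
  simp [CHRRule.headVars, encodeRule, goalVars, storeVars]

variable {p}

theorem mem_goalVars_headOf_node (v : p.L.graph.V) :
    η (.node v) ∈ goalVars (headOf CT p η) := by
  rw [headOf_eq_map]
  refine mem_vars_of_mem_map _ (.inl v) ?_
  rw [headConstraint, vars_nodeConstraint]
  exact .inl rfl

theorem mem_goalVars_headOf_edge (e : p.L.graph.E) :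
    η (.edge e) ∈ goalVars (headOf CT p η) := by
  rw [headOf_eq_map]
  refine mem_vars_of_mem_map _ (.inr e) ?_
  rw [headConstraint, vars_edgeConstraint]
  exact .inl (.inl rfl)

theorem mem_goalVars_headOf_degree (k : p.K.graph.V) :
    η (.degree (p.l.onV k)) ∈ goalVars (headOf CT p η) := by
  rw [headOf_eq_map]
  refine mem_vars_of_mem_map _ (.inl (p.l.onV k)) ?_
  rw [headConstraint, vars_nodeConstraint, headDegree, if_pos ⟨k, rfl⟩]
  exact .inr rfl

theorem mem_bodyOnlyVars {z : RuleVar p} (hz : z.IsBodyVar) :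
    η z ∈ (encodeRule CT p η).bodyOnlyVars := by
  classical
  refine ⟨.inl ?_, ?_⟩
  · simp only [encodeRule, bodyUserOf, mem_goalVars_add, mem_goalVars_map, vars_nodeConstraint,
      vars_edgeConstraint]
    cases z with
    | node v => exact hz.elim
    | edge v => exact hz.elim
    | degree v => exact hz.elim
    | newNode v =>
      exact .inl (.inl (.inl ⟨v, Finset.mem_filter.2 ⟨Finset.mem_univ _, hz⟩, .inl rfl⟩))
    | newEdge e =>
      exact .inl (.inl (.inr ⟨e, Finset.mem_filter.2 ⟨Finset.mem_univ _, hz⟩, .inl (.inl rfl)⟩))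
    | primeNode k => exact .inr ⟨k, Finset.mem_univ _, .inl rfl⟩
    | primeDegree k => exact .inr ⟨k, Finset.mem_univ _, .inr rfl⟩
  · rw [headVars_encodeRule]
    intro h
    obtain ⟨z', hz', heq⟩ := exists_of_mem_goalVars_headOf CT p η h
    exact hz' (η.injective heq ▸ hz)

/-- Every other variable of the body already occurs in the head: identifiers of preserved nodes and
edges, and the degree variables of preserved nodes. This verifies the freshness condition of a
transition in the completeness direction; `mem_bodyOnlyVars` exploits it for soundness. -/
theorem exists_of_mem_bodyOnlyVars {x : X} (hx : x ∈ (encodeRule CT p η).bodyOnlyVars) :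
    ∃ z : RuleVar p, z.IsBodyVar ∧ η z = x := by
  classical
  obtain ⟨hx, hhead⟩ := hx
  rw [headVars_encodeRule] at hhead
  have hnode : ∀ v, x ≠ η (.node v) := fun v h => hhead (h ▸ mem_goalVars_headOf_node CT η v)
  have hedge : ∀ v, x ≠ η (.edge v) := fun v h => hhead (h ▸ mem_goalVars_headOf_edge CT η v)
  have hdegree : ∀ v, x ≠ η (.degree (p.l.onV v)) :=
    fun v h => hhead (h ▸ mem_goalVars_headOf_degree CT η v)
  have hnodeR : ∀ v, x = η (RuleVar.nodeR p v) → ∃ z : RuleVar p, z.IsBodyVar ∧ η z = x := by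
    intro v hv
    by_cases h : v ∈ Set.range p.r.onV
    · obtain ⟨k, rfl⟩ := h
      rw [nodeR_inclusion] at hv
      exact absurd hv (hnode _)
    · rw [nodeR_new p h] at hv
      exact ⟨.newNode v, h, hv.symm⟩
  rcases hx with hx | hx
  · simp only [encodeRule, bodyUserOf, mem_goalVars_add, mem_goalVars_map, vars_nodeConstraint,
      vars_edgeConstraint] at hx
    rcases hx with ((⟨v, hv, hx | hx⟩ | ⟨e, he, (hx | hx) | hx⟩) | ⟨e, -, (hx | hx) | hx⟩) |
      ⟨k, -, hx | hx⟩
    · exact ⟨.newNode v, (Finset.mem_filter.1 hv).2, hx.symm⟩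
    · rw [termVars_num] at hx; exact hx.elim
    · exact ⟨.newEdge e, (Finset.mem_filter.1 he).2, hx.symm⟩
    · exact hnodeR _ hx
    · exact hnodeR _ hx
    · exact absurd hx (hedge _)
    · exact absurd hx (hnode _)
    · exact absurd hx (hnode _)
    · exact ⟨.primeNode k, trivial, hx.symm⟩
    · exact ⟨.primeDegree k, trivial, hx.symm⟩
  · obtain ⟨d, hd, hx⟩ := hx
    obtain ⟨k, -, hd⟩ := List.mem_flatMap.1 hd
    simp only [List.mem_cons, List.not_mem_nil, or_false] at hd
    rcases hd with rfl | rfl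
    · rcases hx with hx | hx
      · exact absurd hx (hnode _)
      · exact ⟨.primeNode k, trivial, hx.symm⟩
    · rcases hx with hx | hx
      · exact ⟨.primeDegree k, trivial, hx.symm⟩
      · obtain ⟨i, hi⟩ := Set.mem_iUnion.1 hx
        revert hi
        refine (Fin.forall_fin_two (p := fun i => x ∈ termVars ((![CT.sub.apply₂
          (.var (η (.degree (p.l.onV k)))) (CT.num (p.L.graph.deg (p.l.onV k))).term,
          (CT.num (p.R.graph.deg (p.r.onV k))).term] : Fin 2 → L.Term X) i) →
            ∃ z : RuleVar p, z.IsBodyVar ∧ η z = x)).2 ⟨?_, ?_⟩ i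
        · intro hi
          obtain ⟨j, hj⟩ := Set.mem_iUnion.1 hi
          revert hj
          refine (Fin.forall_fin_two (p := fun j => x ∈ termVars ((![
            .var (η (.degree (p.l.onV k))), (CT.num (p.L.graph.deg (p.l.onV k))).term] :
              Fin 2 → L.Term X) j) → ∃ z : RuleVar p, z.IsBodyVar ∧ η z = x)).2 ⟨?_, ?_⟩ j
          · intro hj
            exact absurd hj (hdegree k)
          · intro hj
            have : x ∈ termVars (CT.num (p.L.graph.deg (p.l.onV k))).term := hj
            rw [termVars_num] at this
            exact this.elim
        · intro hi
          have : x ∈ termVars (CT.num (p.R.graph.deg (p.r.onV k))).term := hi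
          rw [termVars_num] at this
          exact this.elim

/-! ### Completeness -/

instance (p : ProdRule TG) : Finite (RuleVar p) := by
  let f : p.L.graph.V ⊕ p.L.graph.E ⊕ p.L.graph.V ⊕ p.R.graph.V ⊕ p.R.graph.E ⊕
      p.K.graph.V ⊕ p.K.graph.V → RuleVar p :=
    Sum.elim .node (Sum.elim .edge (Sum.elim .degree (Sum.elim .newNode (Sum.elim .newEdge
      (Sum.elim .primeNode .primeDegree)))))
  refine Finite.of_surjective f ?_
  rintro (v | v | v | v | v | v | v)
  · exact ⟨.inl v, rfl⟩
  · exact ⟨.inr (.inl v), rfl⟩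
  · exact ⟨.inr (.inr (.inl v)), rfl⟩
  · exact ⟨.inr (.inr (.inr (.inl v))), rfl⟩
  · exact ⟨.inr (.inr (.inr (.inr (.inl v)))), rfl⟩
  · exact ⟨.inr (.inr (.inr (.inr (.inr (.inl v))))), rfl⟩
  · exact ⟨.inr (.inr (.inr (.inr (.inr (.inr v))))), rfl⟩

variable {G : TypedGraph TG} {m : p.L ⟶ G}

/-- Distinct identifier variables for the nodes and edges of `G` that extend those of the head. -/
theorem exists_item_variables [Infinite X] (hV : Function.Injective m.onV)
    (hE : Function.Injective m.onE) :
    ∃ y : Item G → X, Function.Injective y ∧ (∀ v, y (.inl (m.onV v)) = η (.node v)) ∧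
      (∀ e, y (.inr (m.onE e)) = η (.edge e)) ∧
      ∀ i z, y i = η z → (∃ v, z = .node v) ∨ ∃ e, z = .edge e := by
  classical
  -- Matched items take the variables of the head; the others take variables outside the whole rule,
  -- hence distinct from its degree and body variables.
  obtain ⟨y₀, hy₀, hfresh⟩ := exists_fresh (Item G) (Set.finite_range η)
  let μ : Item p.L → Item G := Sum.map m.onV m.onE
  have hμ : Function.Injective μ := Sum.map_injective.2 ⟨hV, hE⟩
  let z₀ : Item p.L → RuleVar p := Sum.elim .node .edge
  have hz₀ : Function.Injective z₀ := by
    rintro (v | e) (v' | e') h <;> cases h <;> rfl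
  let y : Item G → X := Function.extend μ (fun j => η (z₀ j)) (fun i => y₀ i 0)
  have h1 : ∀ j, y (μ j) = η (z₀ j) := fun j => hμ.extend_apply _ _ j
  have h2 : ∀ i, i ∉ Set.range μ → y i = y₀ i 0 := fun i hi => Function.extend_apply' _ _ _ hi
  refine ⟨y, ?_, fun v => h1 (.inl v), fun e => h1 (.inr e), ?_⟩
  · intro i i' h
    by_cases hi : i ∈ Set.range μ <;> by_cases hi' : i' ∈ Set.range μ
    · obtain ⟨j, rfl⟩ := hi
      obtain ⟨j', rfl⟩ := hi'
      rw [h1, h1] at h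
      rw [hz₀ (η.injective h)]
    · obtain ⟨j, rfl⟩ := hi
      rw [h1, h2 _ hi'] at h
      exact absurd ⟨_, h⟩ (hfresh _ _)
    · obtain ⟨j, rfl⟩ := hi'
      rw [h1, h2 _ hi] at h
      exact absurd ⟨_, h.symm⟩ (hfresh _ _)
    · rw [h2 _ hi, h2 _ hi'] at h
      exact (hy₀ _ _ _ _ h).1
  · intro i z hiz
    by_cases hi : i ∈ Set.range μ
    · obtain ⟨j, rfl⟩ := hi
      rw [h1] at hiz
      rw [← η.injective hiz]
      rcases j with v | e
      · exact .inl ⟨v, rfl⟩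
      · exact .inr ⟨e, rfl⟩
    · rw [h2 _ hi] at hiz
      exact absurd ⟨_, hiz.symm⟩ (hfresh _ _)

/-- Completeness: if a production rule applies to `G`, then a state that represents `G` matches
the encoded rule. -/
theorem exists_represents_headOf_add [Infinite X] (hV : Function.Injective m.onV)
    (hE : Function.Injective m.onE) (hd : NoDangling p m) :
    ∃ (A : Multiset (UserConstraint L (typeArity TG) X)) (B : List (Builtin L X)),
      Represents CT ⟨headOf CT p η + A, B, ∅⟩ G ∧
      ∀ z : RuleVar p, z.IsBodyVar → η z ∉ goalVars A ∧ η z ∉ storeVars B := by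
  classical
  obtain ⟨y, hy, hyV, hyE, hyη⟩ := exists_item_variables η hV hE
  have hdeg := (noDangling_iff_deg hV hE).1 hd
  -- Preserved nodes carry the degree variable of the head, all others a numeral. At a deleted node
  -- this numeral is the one in the head, by the dangling condition.
  let t : G.graph.V → L.Term X := fun v =>
    if h : ∃ k, m.onV (p.l.onV k) = v then .var (η (.degree (p.l.onV h.choose)))
    else (CT.num (G.graph.deg v)).term
  have ht1 : ∀ k, t (m.onV (p.l.onV k)) = .var (η (.degree (p.l.onV k))) := by
    intro k
    have h : ∃ k', m.onV (p.l.onV k') = m.onV (p.l.onV k) := ⟨k, rfl⟩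
    have h1 : t (m.onV (p.l.onV k)) = .var (η (.degree (p.l.onV h.choose))) := dif_pos h
    rw [h1, hV h.choose_spec]
  have ht2 : ∀ v, (¬ ∃ k, m.onV (p.l.onV k) = v) → t v = (CT.num (G.graph.deg v)).term :=
    fun v hv => dif_neg hv
  let c : Item G → UserConstraint L (typeArity TG) X := fun i => match i with
    | .inl v => nodeConstraint (G.type.onV v) (.var (y (.inl v))) (t v)
    | .inr e => edgeConstraint (G.type.onE e) (.var (y (.inr e)))
        (.var (y (.inl (G.graph.src e)))) (.var (y (.inl (G.graph.tgt e))))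
  have hcV : ∀ v, c (.inl (m.onV v)) = headConstraint CT p η (.inl v) := by
    intro v
    have h1 : t (m.onV v) = headDegree CT p η v := by
      by_cases hv : v ∈ Set.range p.l.onV
      · obtain ⟨k, rfl⟩ := hv
        rw [ht1, headDegree, if_pos ⟨k, rfl⟩]
      · rw [ht2, headDegree, if_neg hv, hdeg v hv]
        rintro ⟨k, hk⟩
        exact hv ⟨k, hV hk⟩
    simp only [c, headConstraint, h1, hyV, m.typeV_comm]
  have hcE : ∀ e, c (.inr (m.onE e)) = headConstraint CT p η (.inr e) := by
    intro e
    simp only [c, headConstraint, hyE, m.typeE_comm, ← m.src_comm, ← m.tgt_comm, hyV]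
  let A : Multiset (UserConstraint L (typeArity TG) X) :=
    (Finset.univ : Finset {v // v ∉ Set.range m.onV}).val.map
      (fun v : {v // v ∉ Set.range m.onV} => c (.inl v.1)) +
    (Finset.univ : Finset {e // e ∉ Set.range m.onE}).val.map
      (fun e : {e // e ∉ Set.range m.onE} => c (.inr e.1))
  have hA : headOf CT p η + A = (Finset.univ : Finset (Item G)).val.map c := by
    rw [headOf_eq_map, map_univ_sum, map_univ_sum, map_univ_range hV, map_univ_range hE]
    simp only [hcV, hcE]
    exact add_add_add_comm _ _ _ _
  -- The store only has to fix the degree variables of the preserved nodes; identifiers stay free.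
  let B : List (Builtin L X) := (Finset.univ : Finset p.K.graph.V).toList.map fun k =>
    .eq (.var (η (.degree (p.l.onV k)))) (CT.num (G.graph.deg (m.onV (p.l.onV k)))).term
  have hB : ∀ (M : CT.Model) (ν : X → M), StoreHolds ν B ↔
      ∀ k, ν (η (.degree (p.l.onV k))) = degVal CT M G (m.onV (p.l.onV k)) := by
    intro M ν
    simp only [StoreHolds, B, List.mem_map, Finset.mem_toList, Finset.mem_univ, true_and,
      forall_exists_index, forall_apply_eq_imp_iff]
    refine forall_congr' fun k => ?_
    simp [Builtin.Holds, ConstraintTheory.val, degVal]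
  have heval : ∀ (M : CT.Model) (ν : X → M), StoreHolds ν B →
      (fun i => (c i).eval ν) = pattern G (fun i => ν (y i)) (degVal CT M G) := by
    intro M ν hν
    rw [hB] at hν
    funext i
    rcases i with v | e
    · refine (eval_nodeConstraint ν _ _ _).trans ?_
      have : (t v).realize ν = degVal CT M G v := by
        by_cases h : ∃ k, m.onV (p.l.onV k) = v
        · obtain ⟨k, rfl⟩ := h
          rw [ht1, Term.realize_var, hν]
        · rw [ht2 v h, CT.realize_num]
          rfl
      rw [this]
      rfl
    · exact eval_edgeConstraint ν _ _ _ _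
  refine ⟨A, B, ⟨c, hA, fun M ν₀ => Set.Subset.antisymm ?_ ?_⟩, ?_⟩
  · rintro _ ⟨ν, -, hν, rfl⟩
    exact ⟨_, (heval M ν hν).symm⟩
  · rintro _ ⟨x, rfl⟩
    -- Degrees are assigned before identifiers; the second assignment leaves them intact because no
    -- identifier variable is a degree variable.
    let ν₁ : X → M := Function.extend (fun v => η (.degree v))
      (fun v => degVal CT M G (m.onV v)) ν₀
    let ν : X → M := Function.extend y x ν₁
    have hν1 : ∀ i, ν (y i) = x i := hy.extend_apply x ν₁
    have hν2 : ∀ v, ν (η (.degree v)) = degVal CT M G (m.onV v) := by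
      intro v
      have h1 : ν (η (.degree v)) = ν₁ (η (.degree v)) := by
        refine Function.extend_apply' _ _ _ ?_
        rintro ⟨i, hi⟩
        rcases hyη i _ hi with ⟨_, h⟩ | ⟨_, h⟩ <;> cases h
      have hinj : Function.Injective fun v => η (RuleVar.degree v) := by
        intro v v' h
        cases η.injective h
        rfl
      rw [h1]
      exact hinj.extend_apply _ _ v
    have hνB : StoreHolds ν B := (hB M ν).2 fun k => hν2 _
    refine ⟨ν, fun y hy => absurd hy (Finset.notMem_empty y), hνB, ?_⟩
    rw [heval M ν hνB]
    simp only [hν1]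
  · intro z hz
    have hzy : ∀ i, η z ≠ y i := by
      intro i hi
      rcases hyη i z hi.symm with ⟨v, rfl⟩ | ⟨v, rfl⟩ <;> exact hz
    refine ⟨?_, ?_⟩
    · simp only [A, mem_goalVars_add, mem_goalVars_map, c, vars_nodeConstraint,
        vars_edgeConstraint]
      rintro (⟨v, -, h | h⟩ | ⟨e, -, (h | h) | h⟩)
      · exact hzy _ h
      · rw [ht2, termVars_num] at h
        · exact h
        · rintro ⟨k, hk⟩
          exact v.2 ⟨_, hk⟩
      · exact hzy _ h
      · exact hzy _ h
      · exact hzy _ h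
    · rintro ⟨d, hd, h⟩
      obtain ⟨k, -, rfl⟩ := List.mem_map.1 hd
      rcases h with h | h
      · have := η.injective h
        subst this
        exact hz
      · rw [termVars_num] at h
        exact h

end Rule

/-! ### Simulation -/

variable {CT} {S : GTS TG} {η : (p : ProdRule TG) → RuleVar p ↪ X}

/-- The transition may start from another member of the class of `σ`, one that exhibits the head; by
invariance this member represents `G` too. -/
theorem Represents.exists_step {σ : CHRState L (typeArity TG) X} {G : TypedGraph TG}
    (hσ : Represents CT σ G) {s : StateClass CT (typeArity TG) X}
    (h : CHRStep CT (gtsProgram CT S η) (σ.cls CT) s) :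
    ∃ (H : TypedGraph TG) (τ : CHRState L (typeArity TG) X),
      S.Step G H ∧ s = τ.cls CT ∧ Represents CT τ H := by
  generalize hs : σ.cls CT = s₀ at h
  obtain ⟨r₀, ⟨p, hp, rfl⟩, ρ, hρ, r, rfl, A, B, V, hV, hGB, -⟩ := h
  rw [cls_eq_iff] at hs
  rw [represents_of_equiv hs] at hσ
  rw [rename_encodeRule CT p (η p) ρ hρ] at hσ hV hGB ⊢
  have hfresh : ∀ z : RuleVar p, z.IsBodyVar → ((η p).trans ⟨ρ, hρ⟩) z ∉ V ∧
      ((η p).trans ⟨ρ, hρ⟩) z ∉ goalVars A ∧ ((η p).trans ⟨ρ, hρ⟩) z ∉ storeVars B := by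
    intro z hz
    have hmem := mem_bodyOnlyVars CT ((η p).trans ⟨ρ, hρ⟩) hz
    exact ⟨fun h => Set.disjoint_left.1 hV (.inr hmem) h,
      fun h => Set.disjoint_left.1 hGB hmem (.inl h),
      fun h => Set.disjoint_left.1 hGB hmem (.inr h)⟩
  simp only [encodeRule, zero_add, List.nil_append] at hσ ⊢
  obtain ⟨m, H, hder, hH⟩ := hσ.exists_derivation hfresh
  exact ⟨H, _, ⟨p, hp, m, hder⟩, rfl, hH⟩

theorem Represents.exists_reflTransGen {σ : CHRState L (typeArity TG) X} {G : TypedGraph TG}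
    (hσ : Represents CT σ G) {s : StateClass CT (typeArity TG) X}
    (h : Relation.ReflTransGen (CHRStep CT (gtsProgram CT S η)) (σ.cls CT) s) :
    ∃ (H : TypedGraph TG) (τ : CHRState L (typeArity TG) X),
      Relation.ReflTransGen S.Step G H ∧ s = τ.cls CT ∧ Represents CT τ H := by
  induction h with
  | refl => exact ⟨G, σ, .refl, rfl, hσ⟩
  | tail _ hstep ih =>
    obtain ⟨H, τ, hGH, rfl, hτ⟩ := ih
    obtain ⟨H', τ', hstep', h', hτ'⟩ := hτ.exists_step hstep
    exact ⟨H', τ', hGH.tail hstep', h', hτ'⟩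

/-- If a rule applied to `G`, a state of `G` showing its encoded head would have a transition. That
state is equivalent to `σ`, so the class of `σ` would not be final. -/
theorem Represents.final [Infinite X] {σ : CHRState L (typeArity TG) X} {G : TypedGraph TG}
    (hσ : Represents CT σ G) (h : CHRFinal CT (gtsProgram CT S η) (σ.cls CT)) : S.Final G := by
  rintro H ⟨p, hp, m, hder⟩
  obtain ⟨A, B, hrep, hfresh⟩ :=
    exists_represents_headOf_add CT (η p) hder.1 hder.2.1 hder.noDangling
  -- The state was built from the rule's own variables and has no globals, so the identity serves as
  -- the fresh renaming.
  have hr : encodeRule CT p (η p) = (encodeRule CT p (η p)).rename id := by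
    rw [rename_encodeRule CT p (η p) id Function.injective_id]
    rfl
  have hstep := CHRStep.apply (CT := CT) (P := gtsProgram CT S η) (encodeRule CT p (η p))
    ⟨p, hp, rfl⟩ id Function.injective_id _ hr A B ∅ (by simp)
    (by
      rw [Set.disjoint_left]
      intro x hx hx'
      obtain ⟨z, hz, rfl⟩ := exists_of_mem_bodyOnlyVars CT (η p) hx
      exact hx'.elim (hfresh z hz).1 (hfresh z hz).2)
    (fun M => by simpa [encodeRule] using hrep.instances_nonempty M)
  have heq : CHRState.cls CT ⟨(encodeRule CT p (η p)).kept + (encodeRule CT p (η p)).removed + A,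
      (encodeRule CT p (η p)).guard ++ B, ∅⟩ = σ.cls CT := by
    rw [cls_eq_iff]
    refine Represents.equiv ?_ hσ
    simpa [encodeRule] using hrep
  rw [heq] at hstep
  exact h _ hstep

end GTSCHR

theorem mainTheorem9 {L : FirstOrder.Language.{a, b}} (CT : GTSCHR.ConstraintTheory L)
    {X : Type w} [Infinite X] {TG : GTSCHR.DirGraph.{u}} (S₁ S₂ : GTSCHR.GTS TG)
    (η₁ η₂ : (p : GTSCHR.ProdRule TG) → GTSCHR.RuleVar p ↪ X)
    (h : GTSCHR.CHROperationallyEquivalent CT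
      (GTSCHR.gtsProgram CT S₁ η₁) (GTSCHR.gtsProgram CT S₂ η₂)) :
    GTSCHR.GTS.OperationallyEquivalent S₁ S₂ := by
  intro G
  obtain ⟨σ, hσ⟩ := GTSCHR.exists_represents (X := X) CT G
  obtain ⟨σ₁, σ₂, h₁, h₂, h₁₂, hf₁, hf₂⟩ := h σ
  obtain ⟨G₁, τ₁, hG₁, e₁, hτ₁⟩ := hσ.exists_reflTransGen h₁
  obtain ⟨G₂, τ₂, hG₂, e₂, hτ₂⟩ := hσ.exists_reflTransGen h₂
  have e₁₂ : τ₁.cls CT = τ₂.cls CT := by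
    rw [← e₁, ← e₂, GTSCHR.cls_eq_iff]
    exact h₁₂
  rw [GTSCHR.cls_eq_iff] at e₁₂
  rw [e₁] at hf₁
  rw [e₂] at hf₂
  exact ⟨G₁, G₂, hG₁, hG₂,
    hτ₁.nonempty_iso ((GTSCHR.represents_of_equiv e₁₂ G₂).2 hτ₂), hτ₁.final hf₁, hτ₂.final hf₂⟩
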